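/- Let $k$ be an algebraically closed field. For a $k$-scheme $Y$ and $n \ge 0$ let $J_nY$ be its $n$-th jet scheme, where $J_n$ is the right adjoint of $Z \mapsto Z\times_k \operatorname{Spec} k[t]/(t^{n+1})$ on $k$-schemes, and for $m \ge n$ let $\pi_{nm}\colon J_mY \to J_nY$ be the truncation morphism. An arc on $Y$ is a $k$-morphism $\gamma\colon \operatorname{Spec} k[[t]] \to Y$, and $\pi_n(\gamma) \in J_nY(k)$ is its restriction to $\operatorname{Spec} k[t]/(t^{n+1})$. Let $Y$ be a local complete intersection $k$-scheme of finite type which is of pure dimension $d$ (every irreducible component of $Y$ has dimension $d$). Let $\mathcal J'_Y$ be its Jacobian ideal sheaf, that is, the $d$-th Fitting ideal sheaf of $\Omega^1_{Y/k}$. Let $\gamma$ be an arc on $Y$ whose order $e := \operatorname{ord}_{\mathcal J'_Y}(\gamma)$, defined by $\gamma^{-1}\mathcal J'_Y\cdot k[[t]] = (t^e)$, is finite. Then for all integers $m, n \ge 0$ with $m \ge n+e \ge 2e$ the scheme-theoretic fibre $\pi_{nm}^{-1}(\pi_n(\gamma))$ is isomorphic over $k$ to the affine space $\mathbb A^{(m-n)d+e}_k$.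 -/

import Mathlib

open CategoryTheory Limits AlgebraicGeometry Polynomial
universe u
noncomputable section
namespace JetScheme

/-! ## Truncated polynomial rings -/

/-- The truncated polynomial ring `R[t]/(t^(n+1))`. -/
abbrev TruncPoly (n : ℕ) (R : Type u) [CommRing R] : Type u :=
  R[X] ⧸ Ideal.span {(X : R[X]) ^ (n + 1)}

/-- Functoriality of `R[t]/(t^(n+1))` in `R`. -/
def TruncPoly.map (n : ℕ) {R R' : Type u} [CommRing R] [CommRing R'] (f : R →+* R') :
    TruncPoly n R →+* TruncPoly n R' :=
  Ideal.quotientMap _ (Polynomial.mapRingHom f) (by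
    rw [Ideal.span_le, Set.singleton_subset_iff]
    simp only [SetLike.mem_coe, Ideal.mem_comap, coe_mapRingHom, Polynomial.map_pow,
      Polynomial.map_X]
    exact Ideal.mem_span_singleton_self _)

lemma TruncPoly.hom_ext {n : ℕ} {R : Type u} {S : Type*} [CommRing R] [CommRing S]
    {f g : TruncPoly n R →+* S}
    (h : f.comp (algebraMap R _) = g.comp (algebraMap R _))
    (hX : f (Ideal.Quotient.mk _ X) = g (Ideal.Quotient.mk _ X)) : f = g := by
  apply Ideal.Quotient.ringHom_ext
  apply Polynomial.ringHom_ext'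
  · exact h
  · exact hX

lemma TruncPoly.isPushout (n : ℕ) {R R' : CommRingCat.{u}} (f : R ⟶ R') :
    IsPushout f (CommRingCat.ofHom (algebraMap R (TruncPoly n R)))
      (CommRingCat.ofHom (algebraMap R' (TruncPoly n R')))
      (CommRingCat.ofHom (TruncPoly.map n f.hom)) := by
  refine ⟨⟨?_⟩, ⟨PushoutCocone.IsColimit.mk _
    (fun s => CommRingCat.ofHom (Ideal.Quotient.lift _
      (Polynomial.eval₂RingHom s.inl.hom (s.inr.hom (Ideal.Quotient.mk _ X))) ?_)) ?_ ?_ ?_⟩⟩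
  · ext x
    change Ideal.Quotient.mk _ (C (f x)) = Ideal.Quotient.mk _ (Polynomial.map f.hom (C x))
    simp
  · intro a ha
    obtain ⟨b, rfl⟩ := Ideal.mem_span_singleton.1 ha
    rw [map_mul, map_pow]
    simp only [coe_eval₂RingHom, eval₂_X]
    rw [← map_pow, ← map_pow, Ideal.Quotient.eq_zero_iff_mem.2 (Ideal.mem_span_singleton_self _)]
    simp
  · intro s
    ext x
    simp only [CommRingCat.comp_apply]
    change Polynomial.eval₂ _ _ (C x) = _
    simp
  · intro s
    ext1
    apply TruncPoly.hom_ext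
    · ext x
      have := congr($(s.condition).hom x)
      simp only [CommRingCat.hom_comp, RingHom.comp_apply] at this
      change Polynomial.eval₂ _ _ (Polynomial.map f.hom (C x)) = _
      simpa using this
    · change Polynomial.eval₂ _ _ (Polynomial.map f.hom X) = _
      simp
  · intro s m h1 h2
    ext1
    apply TruncPoly.hom_ext
    · ext x
      have := congr($(h1).hom x)
      simp only [CommRingCat.hom_comp, RingHom.comp_apply] at this
      change m.hom (algebraMap _ _ x) = Polynomial.eval₂ _ _ (C x)
      simpa using this
    · have := congr($(h2).hom (Ideal.Quotient.mk _ X))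
      simp only [CommRingCat.hom_comp, RingHom.comp_apply] at this
      change m.hom (Ideal.Quotient.mk _ X) = Polynomial.eval₂ _ _ X
      rw [eval₂_X, ← this]
      congr 1
      change _ = Ideal.Quotient.mk _ (Polynomial.map f.hom X)
      simp

/-- Every element is uniquely `∑ j, a j * t^j`. -/
lemma TruncPoly.bijective (n : ℕ) (R : Type u) [CommRing R] : Function.Bijective
    (fun a : Fin (n + 1) → R =>
      ∑ j, algebraMap R (TruncPoly n R) (a j) * (Ideal.Quotient.mk _ X) ^ (j : ℕ)) := by
  have key (a : Fin (n + 1) → R) :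
      ∑ j, algebraMap R (TruncPoly n R) (a j) * (Ideal.Quotient.mk _ X) ^ (j : ℕ) =
      Ideal.Quotient.mk _ (∑ j, C (a j) * X ^ (j : ℕ)) := by
    rw [map_sum]
    refine Finset.sum_congr rfl fun j _ => ?_
    rw [map_mul, map_pow]; rfl
  constructor
  · intro a b hab
    simp only [key] at hab
    rw [Ideal.Quotient.eq, Ideal.mem_span_singleton, Polynomial.X_pow_dvd_iff] at hab
    ext j
    have := hab j j.2
    simp only [coeff_sub, finsetSum_coeff, coeff_C_mul, coeff_X_pow] at this
    simp only [Fin.val_inj, mul_ite, mul_one, mul_zero, Finset.sum_ite_eq, Finset.mem_univ,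
      if_true] at this
    exact sub_eq_zero.1 this
  · intro y
    obtain ⟨p, rfl⟩ := Ideal.Quotient.mk_surjective y
    refine ⟨fun j => p.coeff j, ?_⟩
    simp only [key]
    rw [Ideal.Quotient.eq, Ideal.mem_span_singleton, Polynomial.X_pow_dvd_iff]
    intro d hd
    simp only [coeff_sub, finsetSum_coeff, coeff_C_mul, coeff_X_pow]
    have := Finset.sum_eq_single_of_mem (s := Finset.univ) (f := fun j : Fin (n+1) => p.coeff j * if d = j then 1 else 0) ⟨d, hd⟩ (Finset.mem_univ _) (by
      intro b _ hb
      have : d ≠ b := fun h => hb (Fin.ext h.symm)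
      simp [this])
    rw [this]; simp

/-! ## Existence of jet schemes

The functor `Z ↦ Z × Spec ℤ[t]/(t^(n+1))` on schemes has a right adjoint. This is proved by reduction
to affine targets (Zariski gluing), then to polynomial rings (equalizers).
-/

section thicken

/-- A functorial thickening `Z ↦ D Z → Z` compatible with base change, with a surjective section. -/
structure Thickening where
  D : Scheme.{u} ⥤ Scheme.{u}
  p (Z : Scheme.{u}) : D.obj Z ⟶ Z
  isPullback {W Z : Scheme.{u}} (f : W ⟶ Z) : IsPullback (D.map f) (p W) (p Z) f
  o (Z : Scheme.{u}) : Z ⟶ D.obj Z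
  o_naturality {W Z : Scheme.{u}} (f : W ⟶ Z) : o W ≫ D.map f = f ≫ o Z
  surj (Z : Scheme.{u}) : Surjective (o Z)

variable (𝒯 : Thickening.{u})

namespace Thickening

instance (Z : Scheme.{u}) : Surjective (𝒯.o Z) := 𝒯.surj Z

instance {Z W : Scheme.{u}} (f : W ⟶ Z) [IsOpenImmersion f] : IsOpenImmersion (𝒯.D.map f) :=
  MorphismProperty.of_isPullback (P := @IsOpenImmersion) (𝒯.isPullback f).flip inferInstance

lemma map_isPullback {P W Z V : Scheme.{u}} {f : P ⟶ W} {g : P ⟶ V} {h : W ⟶ Z} {k : V ⟶ Z}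
    (H : IsPullback f g h k) : IsPullback (𝒯.D.map f) (𝒯.D.map g) (𝒯.D.map h) (𝒯.D.map k) := by
  have h1 := (𝒯.isPullback f).paste_vert H
  rw [← (𝒯.isPullback g).w, ← (𝒯.isPullback h).w] at h1
  refine IsPullback.of_bot h1 ?_ (𝒯.isPullback k)
  rw [← Functor.map_comp, H.w, Functor.map_comp]

instance : PreservesLimitsOfShape WalkingCospan 𝒯.D where
  preservesLimit {K} := by
    have : PreservesLimit (cospan (K.map WalkingCospan.Hom.inl) (K.map WalkingCospan.Hom.inr)) 𝒯.D :=
      preservesLimit_of_preserves_limit_cone (pullbackIsPullback _ _)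
        ((𝒯.map_isPullback (.of_hasPullback _ _)).isLimit |> fun h => 
          (isLimitMapConePullbackConeEquiv _ _).symm h)
    exact preservesLimit_of_iso_diagram _ (diagramIsoCospan K).symm

instance : 𝒯.D.IsContinuous Scheme.zariskiTopology Scheme.zariskiTopology := by
  rw [Scheme.zariskiTopology, Scheme.grothendieckTopology]
  have : (Scheme.precoverage @IsOpenImmersion).PullbacksPreservedBy 𝒯.D := by
    refine ⟨fun _ _ hR ↦ ⟨fun _ _ f _ hf _ ↦ ?_⟩⟩
    infer_instance
  apply Functor.isContinuous_toGrothendieck_of_pullbacksPreservedBy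
  intro Z R hR
  obtain ⟨ι, X, f, rfl⟩ := R.exists_eq_ofArrows
  simp only [Precoverage.mem_comap_iff, Presieve.map_ofArrows]
  rw [Scheme.ofArrows_mem_precoverage_iff] at hR ⊢
  refine ⟨fun x => ?_, fun i => ?_⟩
  · obtain ⟨i, y, hy⟩ := hR.1 (𝒯.p Z x)
    have := hR.2 i
    obtain ⟨w, hw, -⟩ := Scheme.Pullback.exists_preimage_pullback x y hy.symm
    refine ⟨i, (𝒯.isPullback (f i)).isoPullback.inv w, ?_⟩
    rw [← Scheme.Hom.comp_apply, IsPullback.isoPullback_inv_fst, hw]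
  · have := hR.2 i
    infer_instance

/-- The presheaf of thickened points of `Y`. -/
abbrev points (Y : Scheme.{u}) : Scheme.{u}ᵒᵖ ⥤ Type u := 𝒯.D.op ⋙ yoneda.obj Y

lemma points_isSheaf (Y : Scheme.{u}) : Presheaf.IsSheaf Scheme.zariskiTopology (𝒯.points Y) := by
  apply Functor.op_comp_isSheaf_of_isSheaf (J := Scheme.zariskiTopology)
    (K := Scheme.zariskiTopology) (F := 𝒯.D)
  rw [isSheaf_iff_isSheaf_of_type]
  exact GrothendieckTopology.Subcanonical.isSheaf_of_isRepresentable _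

lemma o_naturality_assoc {W Z Y : Scheme.{u}} (f : W ⟶ Z) (g : 𝒯.D.obj Z ⟶ Y) :
    𝒯.o W ≫ 𝒯.D.map f ≫ g = f ≫ 𝒯.o Z ≫ g := by
  rw [← Category.assoc, 𝒯.o_naturality, Category.assoc]

/-- Being thickened points in an open subscheme is open. -/
lemma factor_iff {W Z Y U : Scheme.{u}} (a : 𝒯.D.obj Z ⟶ Y) (j : U ⟶ Y) [IsOpenImmersion j]
    (h : W ⟶ Z) : (∃ b : 𝒯.D.obj W ⟶ U, b ≫ j = 𝒯.D.map h ≫ a) ↔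
      ∃ l : W ⟶ ((𝒯.o Z ≫ a) ⁻¹ᵁ j.opensRange).toScheme, l ≫ Scheme.Opens.ι _ = h := by
  constructor
  · rintro ⟨b, hb⟩
    refine ⟨IsOpenImmersion.lift (Scheme.Opens.ι _) h ?_, IsOpenImmersion.lift_fac _ _ _⟩
    rintro _ ⟨w, rfl⟩
    simp only [Scheme.Opens.range_ι]
    change (𝒯.o Z ≫ a) (h w) ∈ Set.range j
    refine ⟨b (𝒯.o W w), ?_⟩
    rw [← Scheme.Hom.comp_apply, ← Scheme.Hom.comp_apply,  hb,
      o_naturality_assoc]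
    rfl
  · rintro ⟨l, rfl⟩
    refine ⟨IsOpenImmersion.lift j (𝒯.D.map (l ≫ Scheme.Opens.ι _) ≫ a) ?_, IsOpenImmersion.lift_fac _ _ _⟩
    rintro _ ⟨w, rfl⟩
    obtain ⟨w, rfl⟩ := (𝒯.o W).surjective w
    rw [← Scheme.Hom.comp_apply, 𝒯.o_naturality_assoc]
    exact (l w).2

/-- Thickened points of an open subscheme form an open subfunctor. -/
lemma presheaf_isOpenImmersion {Y U J : Scheme.{u}} (j : U ⟶ Y) [IsOpenImmersion j]
    (r : (𝒯.points U).RepresentableBy J) :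
    MorphismProperty.presheaf (@IsOpenImmersion)
      (r.toIso.hom ≫ Functor.whiskerLeft 𝒯.D.op (yoneda.map j)) := by
  have key : ∀ ⦃Z : Scheme.{u}⦄ (g : yoneda.obj Z ⟶ 𝒯.points Y), 
     ∃ (b : Scheme.{u}) (snd : b ⟶ Z) (fst : yoneda.obj b ⟶ yoneda.obj J), 
       IsOpenImmersion snd ∧ 
       IsPullback fst (yoneda.map snd) (r.toIso.hom ≫ Functor.whiskerLeft 𝒯.D.op (yoneda.map j)) g := by
    intro Z g
    obtain ⟨a, rfl⟩ := yonedaEquiv.symm.surjective g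
    change 𝒯.D.obj Z ⟶ Y at a
    let V := (𝒯.o Z ≫ a) ⁻¹ᵁ j.opensRange
    obtain ⟨b, hb⟩ := (𝒯.factor_iff a j V.ι).2 ⟨𝟙 _, by simp; rfl⟩
    refine ⟨V.toScheme, V.ι, yoneda.map (r.homEquiv.symm b), inferInstance, ?_⟩
    refine IsPullback.of_forall_isPullback_app fun W => ?_
    rw [Types.isPullback_iff]
    have hr {W : Scheme.{u}} (l : W ⟶ J) : (r.toIso.hom ≫
        Functor.whiskerLeft 𝒯.D.op (yoneda.map j)).app (.op W) l = r.homEquiv l ≫ j := rfl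
    have hg {W : Scheme.{u}} (l : W ⟶ Z) : ((yonedaEquiv (F := 𝒯.points Y)).symm a).app (.op W) l = 𝒯.D.map l ≫ a := rfl
    refine ⟨?_, ?_, ?_⟩
    · ext (l : W.unop ⟶ V.toScheme)
      change (r.toIso.hom ≫ Functor.whiskerLeft 𝒯.D.op (yoneda.map j)).app _ (l ≫ r.homEquiv.symm b)
        = ((yonedaEquiv (F := 𝒯.points Y)).symm a).app _ (l ≫ V.ι)
      erw [hr, hg]
      rw [r.homEquiv_comp, Equiv.apply_symm_apply, Functor.map_comp, Category.assoc, ← hb]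
      exact Category.assoc _ _ _
    · rintro (l : W.unop ⟶ V.toScheme) (l' : W.unop ⟶ V.toScheme) ⟨-, h⟩
      change l ≫ V.ι = l' ≫ V.ι at h
      exact (cancel_mono V.ι).1 h
    · rintro (x : W.unop ⟶ J) (y : W.unop ⟶ Z) h
      erw [hr, hg] at h
      obtain ⟨l, hl⟩ := (𝒯.factor_iff a j y).1 ⟨_, h⟩
      refine ⟨l, ?_, hl⟩
      change l ≫ r.homEquiv.symm b = x
      apply r.homEquiv.injective
      rw [r.homEquiv_comp, Equiv.apply_symm_apply, ← cancel_mono j, h, ← hl, Functor.map_comp,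
        Category.assoc, ← hb]
      exact Category.assoc _ _ _
  refine ⟨fun Z g => ?_, fun Z W g fst snd h => ?_⟩
  · obtain ⟨b, s, f, -, h⟩ := key g
    exact ⟨b, s, f, h⟩
  · obtain ⟨b, s, f, hs, h'⟩ := key g
    let e := h.isoIsPullback _ _ h'
    have he : yoneda.map (yoneda.preimage e.hom ≫ s) = yoneda.map snd := by
      simp [e]
    rw [← yoneda.map_injective he]
    have : IsIso (yoneda.preimage e.hom) := by
      have : IsIso (yoneda.map (yoneda.preimage e.hom)) := by simp; infer_instance
      exact isIso_of_fully_faithful yoneda _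
    infer_instance

/-- Representability of thickened points is local on the target. -/
lemma isRepresentable_of_cover (Y : Scheme.{u}) (𝒰 : Y.OpenCover)
    (h : ∀ i, (𝒯.points (𝒰.X i)).IsRepresentable) : (𝒯.points Y).IsRepresentable := by
  let 𝒱 := 𝒰.ulift
  have h' (i : 𝒱.I₀) : (𝒯.points (𝒱.X i)).IsRepresentable := h _
  have ho (i : 𝒱.I₀) : IsOpenImmersion (𝒱.f i) := 𝒱.map_prop i
  let F : Sheaf Scheme.zariskiTopology.{u} (Type u) := ⟨𝒯.points Y, 𝒯.points_isSheaf Y⟩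
  let f (i : 𝒱.I₀) : yoneda.obj (𝒯.points (𝒱.X i)).reprX ⟶ F.1 :=
    (𝒯.points (𝒱.X i)).representableBy.toIso.hom ≫ Functor.whiskerLeft 𝒯.D.op (yoneda.map (𝒱.f i))
  have hf i : MorphismProperty.presheaf (@IsOpenImmersion) (f i) := 𝒯.presheaf_isOpenImmersion _ _
  have : Presheaf.IsLocallySurjective Scheme.zariskiTopology (Sigma.desc f) := by
    refine ⟨fun {Z} a => ?_⟩
    change 𝒯.D.obj Z ⟶ Y at a
    let V i := (𝒯.o Z ≫ a) ⁻¹ᵁ (𝒱.f i).opensRange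
    have hV : ⨆ i, V i = ⊤ := by
      ext x
      obtain ⟨i, y, hy⟩ := 𝒱.exists_eq (a (𝒯.o Z x))
      simp only [TopologicalSpace.Opens.coe_iSup, Set.mem_iUnion, TopologicalSpace.Opens.coe_top,
        Set.mem_univ, iff_true]
      exact ⟨i, y, hy⟩
    let 𝒲 := Z.openCoverOfIsOpenCover V hV
    refine GrothendieckTopology.superset_covering _ ?_ 𝒲.mem_grothendieckTopology
    rw [Sieve.generate_le_iff]
    rintro _ _ ⟨i : 𝒱.I₀⟩
    obtain ⟨b, hb⟩ := (𝒯.factor_iff a (𝒱.f i) (V i).ι).2 ⟨𝟙 _, by simp; rfl⟩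
    refine ⟨(Sigma.ι (fun i => yoneda.obj (𝒯.points (𝒱.X i)).reprX) i).app _
      ((𝒯.points (𝒱.X i)).representableBy.homEquiv.symm b), ?_⟩
    rw [← NatTrans.comp_app_apply, Sigma.ι_desc]
    change (𝒯.points (𝒱.X i)).representableBy.homEquiv ((𝒯.points (𝒱.X i)).representableBy.homEquiv.symm b) ≫ 𝒱.f i = _
    exact (congrArg (· ≫ 𝒱.f i)
      ((𝒯.points (𝒱.X i)).representableBy.homEquiv.apply_symm_apply b)).trans hb
  exact Scheme.LocalRepresentability.isRepresentable (F := F) hf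

end Thickening
end thicken

section base

/-- The base ring. -/
abbrev Zb : CommRingCat.{u} := .of (ULift.{u} ℤ)

/-- The unique morphism to the terminal scheme. -/
def toB (Z : Scheme.{u}) : Z ⟶ Spec Zb.{u} := specULiftZIsTerminal.from Z

lemma toB_ext {Z : Scheme.{u}} (f g : Z ⟶ Spec Zb.{u}) : f = g :=
  specULiftZIsTerminal.hom_ext _ _

variable (n : ℕ)

/-- `Spec ℤ[t]/(t^(n+1))` -/
abbrev Tb : Scheme.{u} := Spec (.of (TruncPoly n (ULift.{u} ℤ)))

/-- Evaluation at the origin. -/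
def evalZero : TruncPoly n (ULift.{u} ℤ) →+* ULift.{u} ℤ :=
  Ideal.Quotient.lift _ (Polynomial.evalRingHom 0) (by
    intro a ha
    obtain ⟨b, rfl⟩ := Ideal.mem_span_singleton.1 ha
    simp)

/-- The origin. -/
def origin : Spec Zb.{u} ⟶ Tb.{u} n := Spec.map (CommRingCat.ofHom (evalZero n))

instance : Surjective (origin.{u} n) := by
  refine ⟨fun x => ?_⟩
  have hf : Function.Surjective (evalZero.{u} n) :=
    fun y => ⟨Ideal.Quotient.mk _ (C y), by simp [evalZero]⟩
  have := range_comap_of_surjective _ (evalZero n) hf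
  have hx : x ∈ Set.range (PrimeSpectrum.comap (evalZero n)) := by
    rw [this]
    change RingHom.ker (evalZero n) ≤ x.asIdeal
    intro y hy
    obtain ⟨q, rfl⟩ := Ideal.Quotient.mk_surjective y
    have hq : q.eval 0 = 0 := by simpa [evalZero] using hy
    have hq' : X ∣ q := by rw [Polynomial.X_dvd_iff, Polynomial.coeff_zero_eq_eval_zero, hq]
    obtain ⟨r, rfl⟩ := hq'
    apply x.2.mem_of_pow_mem (n + 1)
    rw [← map_pow, mul_pow, map_mul,
      Ideal.Quotient.eq_zero_iff_mem.2 (Ideal.mem_span_singleton_self _), zero_mul]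
    exact zero_mem _
  exact hx

/-- The thickening `Z ↦ Z × Spec ℤ[t]/(t^(n+1))`. -/
def thick : Thickening.{u} where
  D :=
    { obj Z := pullback (toB Z) (toB (Tb n))
      map {W Z} f := pullback.lift (pullback.fst _ _ ≫ f) (pullback.snd _ _) (toB_ext _ _)
      map_comp f g := by
        apply pullback.hom_ext
        · rw [pullback.lift_fst, Category.assoc, pullback.lift_fst,
            pullback.lift_fst_assoc, Category.assoc]
        · rw [pullback.lift_snd, Category.assoc, pullback.lift_snd, pullback.lift_snd] }
  p Z := pullback.fst _ _
  isPullback {W Z} f := by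
    refine IsPullback.of_right (h₁₂ := pullback.snd _ _) (h₂₂ := toB Z) (v₁₃ := toB (Tb n)) ?_ ?_ ?_
    · rw [pullback.lift_snd, toB_ext (f ≫ toB Z) (toB W)]
      exact (IsPullback.of_hasPullback _ _).flip
    · exact pullback.lift_fst _ _ _
    · exact (IsPullback.of_hasPullback _ _).flip
  o Z := pullback.lift (𝟙 Z) (toB Z ≫ origin n) (toB_ext _ _)
  o_naturality {W Z} f := by
    apply pullback.hom_ext
    · simp only [Category.assoc]
      rw [pullback.lift_fst, pullback.lift_fst, pullback.lift_fst_assoc, Category.comp_id,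
        Category.id_comp]
    · simp only [Category.assoc, pullback.lift_snd]
      rw [← Category.assoc, toB_ext (f ≫ toB Z) (toB W)]
  surj Z := by
    have : IsPullback (pullback.lift (𝟙 Z) (toB Z ≫ origin n) (toB_ext _ _) :
        Z ⟶ pullback (toB Z) (toB (Tb n))) (toB Z) (pullback.snd _ _) (origin n) := by
      refine IsPullback.of_right (h₁₂ := pullback.fst _ _) (h₂₂ := toB (Tb n)) (v₁₃ := toB Z) ?_ ?_ ?_
      · rw [pullback.lift_fst, toB_ext (origin n ≫ toB _) (𝟙 _)]
        exact IsPullback.of_id_fst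
      · exact pullback.lift_snd _ _ _
      · exact (IsPullback.of_hasPullback _ _)
    exact MorphismProperty.of_isPullback (P := @Surjective) this.flip inferInstance

/-- The coordinate `t` on the thickening. -/
def toTb (Z : Scheme.{u}) : (thick n).D.obj Z ⟶ Tb n := pullback.snd (toB Z) (toB (Tb n))

/-- The coordinate `t`. -/
def tau (Z : Scheme.{u}) : Γ((thick n).D.obj Z, ⊤) :=
  (toTb n Z).appTop ((Scheme.ΓSpecIso _).inv (Ideal.Quotient.mk _ X))

/-- Functions on the thickening from coefficients. -/
def expand (Z : Scheme.{u}) (a : Fin (n + 1) → Γ(Z, ⊤)) : Γ((thick n).D.obj Z, ⊤) :=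
  ∑ j, ((thick n).p Z).appTop (a j) * tau n Z ^ (j : ℕ)

lemma map_toTb {W Z : Scheme.{u}} (f : W ⟶ Z) : (thick n).D.map f ≫ toTb n Z = toTb n W :=
  pullback.lift_snd _ _ _

lemma map_tau {W Z : Scheme.{u}} (f : W ⟶ Z) : ((thick n).D.map f).appTop (tau n Z) = tau n W := by
  rw [tau, tau, ← map_toTb n f, Scheme.Hom.comp_appTop]
  rfl

lemma map_expand {W Z : Scheme.{u}} (f : W ⟶ Z) (a) :
    ((thick n).D.map f).appTop (expand n Z a) = expand n W (fun j => f.appTop (a j)) := by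
  simp only [expand, map_sum, map_mul, map_pow, map_tau]
  refine Finset.sum_congr rfl fun j _ => ?_
  congr 1
  have := congr(Scheme.Hom.appTop $(((thick n).isPullback f).w) (a j))
  rw [Scheme.Hom.comp_appTop, Scheme.Hom.comp_appTop] at this
  exact this

lemma expand_bijective (R : CommRingCat.{u}) : Function.Bijective (expand n (Spec R)) := by
  let φ : Zb.{u} ⟶ R := CommRingCat.ofHom (algebraMap ℤ R |>.comp ULift.ringEquiv.toRingHom)
  have h := isPullback_SpecMap_of_isPushout _ _ _ _ (TruncPoly.isPushout n φ)
  have e1 : Spec.map φ = toB (Spec R) := toB_ext _ _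
  have e2 : Spec.map (CommRingCat.ofHom (algebraMap (Zb.{u}) (TruncPoly n Zb.{u}))) = toB (Tb n) :=
    toB_ext _ _
  rw [e1, e2] at h
  replace h := h.flip
  let P := CommRingCat.of (TruncPoly n R)
  let e : Spec P ≅ (thick n).D.obj (Spec R) := h.flip.isoPullback
  have he1 : e.hom ≫ (thick n).p _ = _ := h.flip.isoPullback_hom_fst
  have he2 : e.hom ≫ toTb n _ = _ := h.flip.isoPullback_hom_snd
  have : IsIso e.hom.appTop := inferInstanceAs (IsIso (Scheme.Γ.map e.hom.op))
  let E : Γ((thick n).D.obj (Spec R), ⊤) ≃+* P :=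
    (asIso e.hom.appTop ≪≫ Scheme.ΓSpecIso P).commRingCatIsoToRingEquiv
  let E' : Γ(Spec R, ⊤) ≃+* R := (Scheme.ΓSpecIso R).commRingCatIsoToRingEquiv
  have key (a) : E (expand n _ a) = ∑ j, algebraMap R (TruncPoly n R) (E' (a j)) *
      (Ideal.Quotient.mk _ X) ^ (j : ℕ) := by
    simp only [expand, map_sum, map_mul, map_pow]
    refine Finset.sum_congr rfl fun j _ => ?_
    congr 1
    · have := congr(Scheme.Hom.appTop $he1 ≫ (Scheme.ΓSpecIso P).hom)
      rw [Scheme.ΓSpecIso_naturality] at this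
      have := congr($this (a j))
      rw [Scheme.Hom.comp_appTop] at this
      exact this
    · congr 1
      have := congr(Scheme.Hom.appTop $he2 ≫ (Scheme.ΓSpecIso P).hom)
      rw [Scheme.ΓSpecIso_naturality] at this
      have := congr($this ((Scheme.ΓSpecIso _).inv (Ideal.Quotient.mk _ X)))
      rw [Scheme.Hom.comp_appTop] at this
      refine this.trans ?_
      rw [CommRingCat.comp_apply]
      refine (congrArg _ ((Scheme.ΓSpecIso (.of (TruncPoly n Zb.{u}))).inv_hom_id_apply
        (Ideal.Quotient.mk _ X))).trans ?_
      change Ideal.Quotient.mk _ (Polynomial.map _ X) = _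
      simp
  have hb := (TruncPoly.bijective n R).comp (E'.bijective.comp_left (α := Fin (n+1)))
  have : E ∘ expand n (Spec R) = _ := funext key
  exact (Function.Bijective.of_comp_iff' E.bijective _).1 (this ▸ hb)

end base

section affine

/-- A morphism of Zariski sheaves that is bijective on affine schemes is an isomorphism. -/
lemma isIso_of_bijective_affine {F G : Sheaf Scheme.zariskiTopology.{u} (Type u)} (φ : F ⟶ G)
    (h : ∀ R : CommRingCat.{u}, Function.Bijective (φ.hom.app (.op (Spec R)))) : IsIso φ := by
  rw [← Sheaf.isLocallyBijective_iff_isIso φ]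
  constructor
  · refine ⟨fun {Z} x y hxy => ?_⟩
    refine GrothendieckTopology.superset_covering _ ?_
      Z.unop.affineCover.mem_grothendieckTopology
    rw [Sieve.generate_le_iff]
    rintro _ _ ⟨i⟩
    apply (h _).1
    erw [NatTrans.naturality_apply, NatTrans.naturality_apply, hxy]
  · refine ⟨fun {Z} s => ?_⟩
    refine GrothendieckTopology.superset_covering _ ?_
      Z.affineCover.mem_grothendieckTopology
    rw [Sieve.generate_le_iff]
    rintro _ _ ⟨i⟩
    exact (h _).2 _

variable (n : ℕ)

lemma thick_isRepresentable_polynomial (I : Type u) :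
    ((thick n).points (Spec (.of (MvPolynomial I (ULift.{u} ℤ))))).IsRepresentable := by
  let H : Scheme.{u} := Spec (.of (MvPolynomial (I × Fin (n + 1)) (ULift.{u} ℤ)))
  let eH (Z : Scheme.{u}) : (Z ⟶ H) ≃ (I × Fin (n + 1) → Γ(Z, ⊤)) :=
    AffineSpace.toSpecMvPolyIntEquiv _
  let eG (Z : Scheme.{u}) : (Z ⟶ Spec (.of (MvPolynomial I (ULift.{u} ℤ)))) ≃ (I → Γ(Z, ⊤)) :=
    AffineSpace.toSpecMvPolyIntEquiv _
  let a : (thick n).D.obj H ⟶ Spec (.of (MvPolynomial I (ULift.{u} ℤ))) :=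
    (eG _).symm fun i => expand n H fun j => eH H (𝟙 H) (i, j)
  let F : Sheaf Scheme.zariskiTopology.{u} (Type u) := Scheme.zariskiTopology.yoneda.obj H
  let G : Sheaf Scheme.zariskiTopology.{u} (Type u) :=
    ⟨(thick n).points (Spec (.of (MvPolynomial I (ULift.{u} ℤ)))), (thick n).points_isSheaf _⟩
  let φ : F ⟶ G := ⟨(yonedaEquiv (F := G.1)).symm a⟩
  have hφ (Z : Scheme.{u}) (f : Z ⟶ H) (i : I) :
      eG _ ((thick n).D.map f ≫ a) i = expand n Z fun j => eH _ f (i, j) := by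
    refine (AffineSpace.toSpecMvPolyIntEquiv_comp _ ((thick n).D.map f) a i).trans ?_
    have : AffineSpace.toSpecMvPolyIntEquiv I a i = expand n H fun j => eH H (𝟙 H) (i, j) :=
      congrFun ((eG _).apply_symm_apply _) i
    rw [this, map_expand]
    refine congrArg (expand n Z) (funext fun j => ?_)
    exact (AffineSpace.toSpecMvPolyIntEquiv_comp _ f (𝟙 H) (i, j)).symm.trans (by rw [Category.comp_id])
  have : IsIso φ := by
    refine isIso_of_bijective_affine φ fun R => ?_
    have hb := expand_bijective n R
    change Function.Bijective fun f : Spec R ⟶ H => (thick n).D.map f ≫ a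
    constructor
    · intro f g hfg
      apply (eH _).injective
      ext ⟨i, j⟩
      have := congr(eG _ $hfg i)
      rw [hφ, hφ] at this
      exact congrFun (hb.1 this) j
    · intro b
      choose c hc using fun i => hb.2 (eG _ b i)
      refine ⟨(eH _).symm fun ij => c ij.1 ij.2, ?_⟩
      apply (eG _).injective
      ext i
      rw [hφ, ← hc, Equiv.apply_symm_apply]
  exact ⟨H, ⟨Functor.representableByEquiv.symm ((sheafToPresheaf _ _).mapIso (asIso φ))⟩⟩

/-- Morphisms to affine schemes as ring homs. -/
def toRing {W : Scheme.{u}} {R : CommRingCat.{u}} (f : W ⟶ Spec R) : R ⟶ Γ(W, ⊤) :=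
  (Scheme.ΓSpecIso R).inv ≫ f.appTop

lemma toSpecΓ_toRing {W : Scheme.{u}} {R : CommRingCat.{u}} (f : W ⟶ Spec R) :
    W.toSpecΓ ≫ Spec.map (toRing f) = f := by
  rw [toRing, Spec.map_comp, ← Category.assoc, ← Scheme.toSpecΓ_naturality, Category.assoc,
    toSpecΓ_SpecMap_ΓSpecIso_inv, Category.comp_id]

lemma toRing_comp {W : Scheme.{u}} {R S : CommRingCat.{u}} (f : W ⟶ Spec R) (p : S ⟶ R) :
    toRing (f ≫ Spec.map p) = p ≫ toRing f := by
  rw [toRing, toRing, Scheme.Hom.comp_appTop, Scheme.ΓSpecIso_inv_naturality_assoc]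

lemma thick_isRepresentable_affine (B : CommRingCat.{u}) :
    ((thick n).points (Spec B)).IsRepresentable := by
  let P (I : Type u) : CommRingCat.{u} := .of (MvPolynomial I (ULift.{u} ℤ))
  let π₀ : MvPolynomial B (ULift.{u} ℤ) →+* B :=
    MvPolynomial.eval₂Hom ((algebraMap ℤ B).comp ULift.ringEquiv.toRingHom) id
  have hπ : Function.Surjective π₀ := fun b => ⟨.X b, by simp [π₀]⟩
  let K : Type u := RingHom.ker π₀
  let p₀ : MvPolynomial K (ULift.{u} ℤ) →+* MvPolynomial B (ULift.{u} ℤ) :=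
    MvPolynomial.eval₂Hom MvPolynomial.C (fun k => k.1)
  let q₀ : MvPolynomial K (ULift.{u} ℤ) →+* MvPolynomial B (ULift.{u} ℤ) :=
    MvPolynomial.eval₂Hom MvPolynomial.C (fun _ => 0)
  let π : P B ⟶ B := CommRingCat.ofHom π₀
  let p : P K ⟶ P B := CommRingCat.ofHom p₀
  let q : P K ⟶ P B := CommRingCat.ofHom q₀
  have hw : p ≫ π = q ≫ π := by
    ext1
    apply MvPolynomial.ringHom_ext
    · intro r; simp [p, q, π, p₀, q₀]
    · rintro ⟨k, hk⟩
      simpa [p, q, π, p₀, q₀] using hk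
  let c : Fork (Spec.map p) (Spec.map q) := Fork.ofι (Spec.map π) (by
    rw [← Spec.map_comp, ← Spec.map_comp, hw])
  have hπ' : IsClosedImmersion (Spec.map π) := IsClosedImmersion.spec_of_surjective π hπ
  have hc : IsLimit c := by
    refine Fork.IsLimit.mk' _ fun s => ?_
    let ψ := toRing s.ι
    have hs : p ≫ ψ = q ≫ ψ := by
      rw [← toRing_comp, ← toRing_comp]
      exact congrArg _ s.condition
    have hker (x) (hx : π₀ x = 0) : ψ.hom x = 0 := by
      have := congr($(hs).hom (MvPolynomial.X (⟨x, hx⟩ : K)))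
      have h1 : p₀ (.X ⟨x, hx⟩) = x := MvPolynomial.eval₂Hom_X' _ _ _
      have h2 : q₀ (.X ⟨x, hx⟩) = 0 := MvPolynomial.eval₂Hom_X' _ _ _
      change ψ.hom (p₀ (.X ⟨x, hx⟩)) = ψ.hom (q₀ (.X ⟨x, hx⟩)) at this
      rwa [h1, h2, map_zero] at this
    let l₀ : B →+* Γ(s.pt, ⊤) := RingHom.liftOfSurjective π₀ hπ ⟨ψ.hom, hker⟩
    have hl : π ≫ CommRingCat.ofHom l₀ = ψ := by
      apply CommRingCat.hom_ext
      apply RingHom.ext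
      intro x
      exact RingHom.liftOfRightInverse_comp_apply π₀ _ (Function.rightInverse_surjInv hπ) ⟨ψ.hom, hker⟩ x
    refine ⟨s.pt.toSpecΓ ≫ Spec.map (CommRingCat.ofHom l₀), ?_, ?_⟩
    · change (_ ≫ _) ≫ Spec.map π = _
      rw [Category.assoc, ← Spec.map_comp, hl]
      exact toSpecΓ_toRing _
    · intro m hm
      rw [← cancel_mono (Spec.map π), Category.assoc, ← Spec.map_comp, hl]
      exact hm.trans (toSpecΓ_toRing _).symm
  exact Functor.rightAdjointObjIsDefined_of_isLimit (F := (thick n).D) hc (by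
    rintro (_ | _)
    · exact thick_isRepresentable_polynomial n _
    · exact thick_isRepresentable_polynomial n _)

instance thick_isLeftAdjoint : (thick.{u} n).D.IsLeftAdjoint := by
  apply Functor.isLeftAdjoint_of_rightAdjointObjIsDefined_eq_top
  ext Y
  simp only [Functor.rightAdjointObjIsDefined_iff, Pi.top_apply, Prop.top_eq_true, iff_true]
  exact (thick n).isRepresentable_of_cover Y Y.affineCover fun i => thick_isRepresentable_affine n _

end affine

/-! ## Jet schemes of `k`-schemes -/

section relative

variable (k : Type u) [CommRing k] (n : ℕ)

/-- The structure morphism `Spec k[t]/(t^(n+1)) ⟶ Spec k`. -/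
def jetDisc : Spec (.of (TruncPoly n k)) ⟶ Spec (.of k) :=
  Spec.map (CommRingCat.ofHom (algebraMap k (TruncPoly n k)))

/-- The functor `Z ↦ Z ×_k Spec k[t]/(t^(n+1))` on `k`-schemes. -/
def jetThickening : Over (Spec (.of k)) ⥤ Over (Spec (.of k)) where
  obj Z := Over.mk (pullback.fst Z.hom (jetDisc k n) ≫ Z.hom)
  map {W Z} f := Over.homMk (pullback.lift (pullback.fst _ _ ≫ f.left) (pullback.snd _ _)
    (by rw [Category.assoc, Over.w, pullback.condition]))
    ((pullback.lift_fst_assoc _ _ _ _).trans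
      ((Category.assoc _ _ _).trans (congrArg (_ ≫ ·) (Over.w f))))
  map_id Z := by
    ext1
    apply pullback.hom_ext
    · exact (pullback.lift_fst _ _ _).trans ((Category.comp_id _).trans (Category.id_comp _).symm)
    · exact (pullback.lift_snd _ _ _).trans (Category.id_comp _).symm
  map_comp f g := by
    ext1
    apply pullback.hom_ext
    · refine (pullback.lift_fst _ _ _).trans ?_
      refine Eq.trans ?_ (Category.assoc _ _ _).symm
      refine Eq.trans ?_ (congrArg (_ ≫ ·) (pullback.lift_fst _ _ _).symm)
      refine Eq.trans ?_ (pullback.lift_fst_assoc _ _ _ _).symm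
      exact (Category.assoc _ _ _).symm
    · refine (pullback.lift_snd _ _ _).trans ?_
      refine Eq.trans ?_ (Category.assoc _ _ _).symm
      refine Eq.trans ?_ (congrArg (_ ≫ ·) (pullback.lift_snd _ _ _).symm)
      exact (pullback.lift_snd _ _ _).symm

/-- The comparison with the base change of the absolute thickening. -/
lemma jetThickening_isPullback (Z : Over (Spec (.of k))) :
    IsPullback (pullback.fst Z.hom (jetDisc k n))
      (pullback.snd Z.hom (jetDisc k n) ≫
        Spec.map (CommRingCat.ofHom (TruncPoly.map n
          ((algebraMap ℤ k).comp ULift.ringEquiv.toRingHom))))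
      (toB Z.left) (toB (Tb n)) := by
  let φ : Zb.{u} ⟶ .of k := CommRingCat.ofHom ((algebraMap ℤ k).comp ULift.ringEquiv.toRingHom)
  have h := isPullback_SpecMap_of_isPushout _ _ _ _ (TruncPoly.isPushout n φ)
  rw [toB_ext (Spec.map (CommRingCat.ofHom (algebraMap (Zb.{u}) (TruncPoly n Zb.{u}))))
    (toB (Tb n))] at h
  have h1 : IsPullback (pullback.fst Z.hom (jetDisc k n))
    (pullback.snd Z.hom (jetDisc k n)) Z.hom (jetDisc k n) := .of_hasPullback _ _
  have h2 := h1.flip.paste_horiz h.flip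
  rw [toB_ext (Z.hom ≫ _) (toB _)] at h2
  exact h2.flip

/-- The comparison isomorphism. -/
def jetThickeningIso :
    jetThickening k n ≅ Over.post (X := Spec (.of k)) (thick n).D ⋙ Over.map ((thick n).p _) :=
  NatIso.ofComponents (fun Z => Over.isoMk (jetThickening_isPullback k n Z).isoPullback (by
      change _ ≫ (thick n).D.map Z.hom ≫ (thick n).p _ = _
      refine (congrArg (_ ≫ ·) ((thick n).isPullback Z.hom).w).trans ?_
      refine (Category.assoc _ _ _).symm.trans ?_
      exact congrArg (· ≫ Z.hom) (jetThickening_isPullback k n Z).isoPullback_hom_fst)) (by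
    intro W Z f
    ext1
    apply (IsPullback.of_hasPullback (toB Z.left) (toB (Tb n))).hom_ext
    · refine (Category.assoc _ _ _).trans ?_
      refine (congrArg (_ ≫ ·) (jetThickening_isPullback k n Z).isoPullback_hom_fst).trans ?_
      refine (pullback.lift_fst _ _ _).trans ?_
      refine Eq.trans ?_ (Category.assoc _ _ _).symm
      refine Eq.trans ?_ (congrArg (_ ≫ ·) (pullback.lift_fst _ _ _).symm)
      refine Eq.trans ?_ (Category.assoc _ _ _)
      exact (congrArg (· ≫ f.left) (jetThickening_isPullback k n W).isoPullback_hom_fst).symm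
    · refine (Category.assoc _ _ _).trans ?_
      refine (congrArg (_ ≫ ·) (jetThickening_isPullback k n Z).isoPullback_hom_snd).trans ?_
      refine (pullback.lift_snd_assoc _ _ _ _).trans ?_
      refine Eq.trans ?_ (Category.assoc _ _ _).symm
      refine Eq.trans ?_ (congrArg (_ ≫ ·) (pullback.lift_snd _ _ _).symm)
      exact (jetThickening_isPullback k n W).isoPullback_hom_snd.symm)

instance jetThickening_isLeftAdjoint : (jetThickening k n).IsLeftAdjoint :=
  Functor.isLeftAdjoint_of_iso (jetThickeningIso k n).symm

/-- The jet scheme functor `J_n` on `k`-schemes: the right adjoint of the functor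
`Z ↦ Z ×_k Spec k[t]/(t^(n+1))`. -/
def jetScheme : Over (Spec (.of k)) ⥤ Over (Spec (.of k)) := (jetThickening k n).rightAdjoint

/-- The defining adjunction: `k`-morphisms `Z ⟶ J_n Y` correspond to `k`-morphisms
`Z ×_k Spec k[t]/(t^(n+1)) ⟶ Y`. -/
def jetAdjunction : jetThickening k n ⊣ jetScheme k n := .ofIsLeftAdjoint _

variable {n}

/-- The closed immersion `Spec k[t]/(t^(n+1)) ⟶ Spec k[t]/(t^(m+1))` for `n ≤ m`. -/
def jetDiscMap {m : ℕ} (h : n ≤ m) : Spec (.of (TruncPoly n k)) ⟶ Spec (.of (TruncPoly m k)) :=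
  Spec.map (CommRingCat.ofHom (Ideal.Quotient.factor (Ideal.span_singleton_le_span_singleton.2
    (pow_dvd_pow (X : k[X]) (Nat.succ_le_succ h)))))

lemma jetDiscMap_comp {m : ℕ} (h : n ≤ m) : jetDiscMap k h ≫ jetDisc k m = jetDisc k n := by
  rw [jetDiscMap, jetDisc, jetDisc, ← Spec.map_comp]
  rfl

/-- The natural closed immersion `Z ×_k Spec k[t]/(t^(n+1)) ⟶ Z ×_k Spec k[t]/(t^(m+1))` for
`n ≤ m`. -/
def jetThickeningMap {m : ℕ} (h : n ≤ m) : jetThickening k n ⟶ jetThickening k m where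
  app Z := Over.homMk (pullback.lift (pullback.fst _ _) (pullback.snd _ _ ≫ jetDiscMap k h)
    (pullback.condition.trans ((congrArg (_ ≫ ·) (jetDiscMap_comp k h).symm).trans
      (Category.assoc _ _ _).symm)))
    (pullback.lift_fst_assoc _ _ _ _)
  naturality W Z f := by
    ext1
    apply pullback.hom_ext
    · refine (Category.assoc _ _ _).trans ?_
      refine (congrArg (_ ≫ ·) (pullback.lift_fst _ _ _)).trans ?_
      refine (pullback.lift_fst _ _ _).trans ?_
      refine Eq.trans ?_ (Category.assoc _ _ _).symm
      refine Eq.trans ?_ (congrArg (_ ≫ ·) (pullback.lift_fst _ _ _).symm)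
      exact (pullback.lift_fst_assoc _ _ _ _).symm
    · refine (Category.assoc _ _ _).trans ?_
      refine (congrArg (_ ≫ ·) (pullback.lift_snd _ _ _)).trans ?_
      refine (pullback.lift_snd_assoc _ _ _ _).trans ?_
      refine Eq.trans ?_ (Category.assoc _ _ _).symm
      refine Eq.trans ?_ (congrArg (_ ≫ ·) (pullback.lift_snd _ _ _).symm)
      exact (pullback.lift_snd _ _ _).symm

/-- The truncation morphism `π_{nm} : J_m ⟶ J_n` for `n ≤ m`, obtained by restricting families of
`m`-jets along `Z ×_k Spec k[t]/(t^(n+1)) ⟶ Z ×_k Spec k[t]/(t^(m+1))`. -/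
def jetTruncation {m : ℕ} (h : n ≤ m) : jetScheme k m ⟶ jetScheme k n :=
  conjugateEquiv (jetAdjunction k m) (jetAdjunction k n) (jetThickeningMap k h)

end relative

/-! ## Arcs, Jacobian ideals, local complete intersections -/

section arcs

variable {k : Type u} [CommRing k] (n : ℕ)

/-- The truncation homomorphism `k[[t]] → k[t]/(t^(n+1))`. -/
def truncHom (k : Type u) [CommRing k] : PowerSeries k →+* TruncPoly n k where
  toFun f := Ideal.Quotient.mk _ (PowerSeries.trunc (n + 1) f)
  map_one' := by rw [PowerSeries.trunc_one, map_one]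
  map_zero' := by rw [map_zero, map_zero]
  map_add' f g := by rw [map_add, map_add]
  map_mul' f g := by
    rw [← map_mul, Ideal.Quotient.eq, Ideal.mem_span_singleton, Polynomial.X_pow_dvd_iff]
    intro i hi
    rw [Polynomial.coeff_sub, PowerSeries.coeff_trunc, if_pos hi,
      PowerSeries.coeff_mul_eq_coeff_trunc_mul_trunc f g hi, sub_eq_zero,
      ← Polynomial.coeff_coe, Polynomial.coe_mul]

/-- `Spec k[[t]]` as a `k`-scheme. -/
def formalDisc (k : Type u) [CommRing k] : Over (Spec (.of k)) :=
  Over.mk (Spec.map (CommRingCat.ofHom (algebraMap k (PowerSeries k))) :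
    Spec (.of (PowerSeries k)) ⟶ Spec (.of k))

/-- An arc on `Y`: a `k`-morphism `Spec k[[t]] ⟶ Y`. -/
abbrev Arc (Y : Over (Spec (.of k))) := formalDisc k ⟶ Y

/-- The closed immersion `Spec k[t]/(t^(n+1)) ⟶ Spec k[[t]]`. -/
def discToFormalDisc (k : Type u) [CommRing k] :
    Spec (.of (TruncPoly n k)) ⟶ Spec (.of (PowerSeries k)) :=
  Spec.map (CommRingCat.ofHom (truncHom n k))

lemma discToFormalDisc_comp : discToFormalDisc n k ≫ (formalDisc k).hom = jetDisc k n := by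
  refine (Spec.map_comp _ _).symm.trans (congrArg Spec.map ?_)
  ext x
  change Ideal.Quotient.mk _ (PowerSeries.trunc (n + 1) (PowerSeries.C x)) =
    Ideal.Quotient.mk _ (Polynomial.C x)
  rw [PowerSeries.trunc_C]

/-- The `k`-point `π_n(γ)` of `J_n Y`: it corresponds under the adjunction to
`Spec k[t]/(t^(n+1)) ⟶ Spec k[[t]] ⟶ Y`. -/
def Arc.jet {Y : Over (Spec (.of k))} (γ : Arc Y) :
    Over.mk (𝟙 (Spec (.of k))) ⟶ (jetScheme k n).obj Y :=
  (jetAdjunction k n).homEquiv _ _ (Over.homMk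
    (pullback.snd _ _ ≫ discToFormalDisc n k ≫ γ.left) (by
    refine (Category.assoc _ _ _).trans ?_
    refine (congrArg (_ ≫ ·) ((Category.assoc _ _ _).trans
      ((congrArg (_ ≫ ·) (Over.w γ)).trans (discToFormalDisc_comp n)))).trans ?_
    exact pullback.condition.symm))

/-- The scheme-theoretic fibre of `π_{nm} : J_m Y ⟶ J_n Y` over the `k`-point `π_n(γ)`,
as a `k`-scheme (a fibre product in the category of `k`-schemes). -/
def Arc.jetFibre {m : ℕ} (h : n ≤ m) {Y : Over (Spec (.of k))} (γ : Arc Y) :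
    Over (Spec (.of k)) :=
  pullback ((jetTruncation k h).app Y) (γ.jet n)

/-- The ideal `γ⁻¹I · k[[t]]` of `k[[t]]`, for an ideal sheaf `I` on `Y` and an arc `γ`. -/
def Arc.ideal {Y : Over (Spec (.of k))} (γ : Arc Y) (I : Y.left.IdealSheafData) :
    Ideal (PowerSeries k) :=
  letI f : Spec (.of (PowerSeries k)) ⟶ Y.left := γ.left
  ((I.comap f).ideal ⟨⊤, isAffineOpen_top _⟩).map
    (Scheme.ΓSpecIso (.of (PowerSeries k))).hom.hom

/-- The order `ord_I(γ)` of an ideal sheaf `I` along an arc `γ`: the least `t`-adic order of an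
element of `γ⁻¹I · k[[t]]`. When `k` is a field it is the `e ∈ ℕ ∪ {∞}` with
`γ⁻¹I · k[[t]] = (t^e)`, where `t^∞ = 0`. -/
def Arc.order {Y : Over (Spec (.of k))} (γ : Arc Y) (I : Y.left.IdealSheafData) : ℕ∞ :=
  ⨅ f ∈ γ.ideal I, PowerSeries.order f

/-- The `d`-th Fitting ideal of a finitely generated `R`-module `M`: it is generated by the
`(n-d) × (n-d)` minors of matrices whose rows are relations between generators `x₁, …, xₙ` of `M`
(the unit ideal if `n ≤ d`). Each generating family of `M` gives the same ideal. -/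
def fittingIdeal (d : ℕ) (R M : Type*) [CommRing R] [AddCommGroup M] [Module R M] : Ideal R :=
  Ideal.span {r | ∃ (n : ℕ) (x : Fin n → M) (A : Matrix (Fin (n - d)) (Fin n) R)
    (c : Fin (n - d) → Fin n), Submodule.span R (Set.range x) = ⊤ ∧
      (∀ i, ∑ j, A i j • x j = 0) ∧ (A.submatrix id c).det = r}

/-- The structure homomorphism `k → Γ(Y, U)`. -/
def sectionsHom (Y : Over (Spec (.of k))) (U : Y.left.Opens) : k →+* Γ(Y.left, U) :=
  ((Scheme.ΓSpecIso (.of k)).inv ≫ Y.hom.appLE ⊤ U le_top).hom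

/-- The Jacobian ideal sheaf of a `k`-scheme `Y` of finite type and dimension `d`: the `d`-th
Fitting ideal sheaf of `Ω¹_{Y/k}`. On an affine open `U` it is the `d`-th Fitting ideal of the
module of Kähler differentials of `Γ(Y, U)` over `k`. These ideals are compatible with localization
(Fitting ideals commute with base change), so `ofIdeals`, the largest ideal sheaf contained in a
family of ideals, has exactly these ideals as its values. -/
def jacobianIdeal (d : ℕ) (Y : Over (Spec (.of k))) : Y.left.IdealSheafData :=
  .ofIdeals fun U =>
    letI := (sectionsHom Y U.1).toAlgebra
    fittingIdeal d Γ(Y.left, U.1) (Ω[Γ(Y.left, U.1)⁄k])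

/-- `Y` is a local complete intersection over `k`: each point has an open neighbourhood isomorphic
over `k` to `Spec k[x₁, …, x_N]/(h₁, …, h_c)` for a regular sequence `h₁, …, h_c`. -/
def IsLCI (Y : Over (Spec (.of k))) : Prop :=
  ∀ y : Y.left, ∃ (N : ℕ) (h : List (MvPolynomial (Fin N) k))
    (ι : Spec (.of (MvPolynomial (Fin N) k ⧸ Ideal.ofList h)) ⟶ Y.left),
    RingTheory.Sequence.IsRegular (MvPolynomial (Fin N) k) h ∧ IsOpenImmersion ι ∧
    y ∈ Set.range ι ∧
    ι ≫ Y.hom = Spec.map (CommRingCat.ofHom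
      (algebraMap k (MvPolynomial (Fin N) k ⧸ Ideal.ofList h)))

/-- `Y` has pure dimension `d`: every non-empty open subset has Krull dimension `d`. For a scheme of
finite type over a field this says that every irreducible component has dimension `d`. -/
def IsPureDim (d : ℕ) (Y : Scheme.{u}) : Prop :=
  ∀ U : Y.Opens, (U : Set Y).Nonempty → topologicalKrullDim U = d

end arcs

end JetScheme

end

/-! Near γ(0) the scheme Y is V(h_1, …, h_c) ⊆ 𝔸^N with c = N - d, and γ factors through this chart.
There the Jacobian ideal is generated by the maximal minors of the Jacobian matrix of h
(`fittingIdeal_quotient`). Pulled back along γ, this matrix becomes a c × N matrix J over k[[t]]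
whose maximal minors all have order at least e, with equality for one of them. Row and column
operations over the discrete valuation ring k[[t]] therefore bring J to the form (diag(t^{ε_i}) | 0)
with Σ ε_i = e (`exists_normalForm`).

An R-point of the fibre is a tuple γ + t^{n+1} z, with z a tuple of power series over R taken modulo
t^L, L = m - n, on which h vanishes modulo t^{m+1}. Taylor expansion gives h(γ + t^{n+1} z) =
t^{n+1} (J z + t^{n+1} q(z)). In coordinates z = P w adapted to the normal form the equations read
t^{ε_i} w_i + t^{n+1} q_i(w) ≡ 0 modulo t^L for i ≤ c; the other d coordinates occur only in the q_i
(`exists_isJetLift_iff`).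

Since ε_i ≤ e, and e is at most n and at most L, division by t^{ε_i} is possible: w_i ≡ -t^{n+1-ε_i}
q_i(w) modulo t^{L-ε_i}. Each coefficient on the right involves only lower coefficients of w. So the
top ε_i coefficients of each w_i and all L coefficients of the other d coordinates can be prescribed
arbitrarily, and they determine everything else (`existsUnique_isTriangularSolution`). This gives Ld
+ e free parameters.

All of this is natural in R. The solution whose free coefficients are indeterminates is a universal
point over a polynomial ring in Ld + e variables (`exists_universal_isJetLift`), and the resulting
morphism from affine space to the fibre is bijective on affine points, hence an isomorphism
(`isIso_of_existsUnique_specOverMap`). -/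

noncomputable section
namespace JetScheme

/-! ### Fitting ideals: independence of generators, localization, Jacobian minors. -/

section fitting

/-- The ideal generated by the `r × r` minors of matrices whose rows are relations between the
members of the family `x`. -/
def relationMinors {R M ι : Type*} [CommRing R] [AddCommGroup M] [Module R M] [Fintype ι]
    (r : ℕ) (x : ι → M) : Ideal R :=
  Ideal.span {a | ∃ (A : Matrix (Fin r) ι R) (c : Fin r → ι),
    (∀ i, ∑ j, A i j • x j = 0) ∧ (A.submatrix id c).det = a}

variable {R M ι κ : Type*} [CommRing R] [AddCommGroup M] [Module R M] [Fintype ι] [Fintype κ]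

lemma det_mem_relationMinors {r : ℕ} {x : ι → M} (A : Matrix (Fin r) ι R) (c : Fin r → ι)
    (h : ∀ i, ∑ j, A i j • x j = 0) : (A.submatrix id c).det ∈ relationMinors r x :=
  Ideal.subset_span ⟨A, c, h, rfl⟩

/-- The empty matrix has determinant 1. This covers families of at most `d` generators, where the
truncated difference of the cardinality and `d` is 0. -/
lemma relationMinors_zero (x : ι → M) : relationMinors (R := R) 0 x = ⊤ := by
  rw [Ideal.eq_top_iff_one]
  refine Ideal.subset_span ⟨0, Fin.elim0, fun i => i.elim0, ?_⟩
  simp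

lemma relationMinors_comp_equiv_le (r : ℕ) (x : ι → M) (e : κ ≃ ι) :
    relationMinors (R := R) r (x ∘ e) ≤ relationMinors r x := by
  refine Ideal.span_le.2 ?_
  rintro _ ⟨A, c, h, rfl⟩
  refine Ideal.subset_span ⟨A.submatrix id e.symm, e ∘ c, fun i => ?_, ?_⟩
  · rw [← h i, ← e.sum_comp]
    simp
  · congr 1
    ext i j
    simp

lemma relationMinors_comp_equiv (r : ℕ) (x : ι → M) (e : κ ≃ ι) :
    relationMinors (R := R) r (x ∘ e) = relationMinors r x := by
  refine le_antisymm (relationMinors_comp_equiv_le r x e) ?_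
  have := relationMinors_comp_equiv_le (R := R) r (x ∘ e) e.symm
  simpa [Function.comp_assoc] using this

/-- Adding a redundant generator, first inclusion. -/
lemma relationMinors_le_option (r : ℕ) (x : ι → M) (b : ι → R) :
    relationMinors (R := R) r x ≤
      relationMinors (r + 1) (fun o : Option ι => o.elim (∑ j, b j • x j) x) := by
  refine Ideal.span_le.2 ?_
  rintro _ ⟨A, c, h, rfl⟩
  -- The added row 0 is the relation -y + Σ b_j x_j = 0 that makes y redundant. With the column
  -- `none` placed first, expansion returns the old minor up to sign.
  let B : Matrix (Fin (r + 1)) (Option ι) R := Matrix.of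
    (Fin.cons (fun o => o.elim (-1) b) fun i o => o.elim 0 (A i))
  have hB := det_mem_relationMinors (x := fun o : Option ι => o.elim (∑ j, b j • x j) x) B
    (Fin.cons none (some ∘ c)) (by
      intro i
      refine Fin.cases ?_ (fun i => ?_) i
      · simp [B, Fintype.sum_option]
      · simpa [B, Fintype.sum_option] using h i)
  have : (B.submatrix id (Fin.cons none (some ∘ c))).det = - (A.submatrix id c).det := by
    rw [Matrix.det_succ_column_zero, Fin.sum_univ_succ, Finset.sum_eq_zero]
    · have : (B.submatrix id (Fin.cons none (some ∘ c))).submatrix (Fin.succAbove 0) Fin.succ =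
          A.submatrix id c := by
        ext i j
        simp [B]
      rw [this]
      simp [B]
    · intro i _
      simp [B]
  rw [this] at hB
  simpa using hB

/-- Adding a redundant generator, second inclusion. -/
lemma relationMinors_option_le (r : ℕ) (x : ι → M) (b : ι → R) :
    relationMinors (R := R) (r + 1) (fun o : Option ι => o.elim (∑ j, b j • x j) x) ≤
      relationMinors r x := by
  refine Ideal.span_le.2 ?_
  rintro _ ⟨A, c, h, rfl⟩
  -- Substituting Σ b_j x_j for the redundant generator turns the rows of A into relations between
  -- the x_j alone. There is one row more than the size of the minors wanted.
  let A' : Matrix (Fin (r + 1)) ι R := Matrix.of fun i j => A i (some j) + A i none * b j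
  have hA' (i) : ∑ j, A' i j • x j = 0 := by
    have := h i
    rw [Fintype.sum_option] at this
    simp only [Option.elim_none, Option.elim_some, Finset.smul_sum, smul_smul,
      ← Finset.sum_add_distrib, ← add_smul] at this
    rw [← this]
    exact Finset.sum_congr rfl fun j _ => by simp only [A', Matrix.of_apply, add_comm]
  let v : Fin (r + 1) → R := fun j => (c j).elim (-1) b
  let B : Matrix (Fin (r + 1)) (Fin (r + 1)) R := Matrix.of fun i j => (c j).elim 0 (A' i)
  have hB (i₀ j₀ : Fin (r + 1)) : (B.submatrix i₀.succAbove j₀.succAbove).det ∈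
      relationMinors r x := by
    by_cases hc : ∃ j, c (j₀.succAbove j) = none
    · obtain ⟨j, hj⟩ := hc
      rw [Matrix.det_eq_zero_of_column_eq_zero j (fun i => by simp [B, hj])]
      exact zero_mem _
    · have hs : ∀ j, ∃ l, c (j₀.succAbove j) = some l := fun j =>
        Option.ne_none_iff_exists'.1 fun h => hc ⟨j, h⟩
      choose l hl using hs
      have := det_mem_relationMinors (A'.submatrix i₀.succAbove id) l fun i => hA' _
      convert this using 2
      ext i j
      simp [B, hl]
  -- The minor is bordered by the first row (1, v) and the first column (1, 0, …, 0). Adding `A i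
  -- none` times row 0 to row i + 1 turns a column `none` into 0 and a column `some l` into the
  -- column l of A', as v is -1 or b_l there. Expanding the result along its first column and then
  -- along the first row leaves only r × r minors of `B`.
  let W₀ : Matrix (Fin (r + 2)) (Fin (r + 2)) R :=
    Matrix.of (Fin.cons (Fin.cons 1 v) fun i => Fin.cons 0 fun j => A i (c j))
  let W : Matrix (Fin (r + 2)) (Fin (r + 2)) R :=
    Matrix.of (Fin.cons (Fin.cons 1 v) fun i => Fin.cons (A i none) (B i))
  have hW₀ : W₀.det = (A.submatrix id c).det := by
    rw [Matrix.det_succ_column_zero, Fin.sum_univ_succ, Finset.sum_eq_zero]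
    · have : W₀.submatrix (Fin.succAbove 0) Fin.succ = A.submatrix id c := by
        ext i j
        simp [W₀]
      rw [this]
      simp [W₀]
    · intro i _
      simp [W₀]
  have hW : W.det = W₀.det := by
    refine Matrix.det_eq_of_forall_row_eq_smul_add_const
      (Fin.cons 0 (fun i => A i none)) 0 rfl fun i j => ?_
    refine Fin.cases ?_ (fun i => ?_) i
    · simp [W, W₀]
    · refine Fin.cases ?_ (fun j => ?_) j
      · simp [W, W₀]
      · simp only [W, W₀, Matrix.of_apply, Fin.cons_succ, Fin.cons_zero, v, B]
        cases c j <;> simp [A']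
  rw [SetLike.mem_coe, ← hW₀, ← hW, Matrix.det_succ_column_zero, Fin.sum_univ_succ]
  refine Ideal.add_mem _ (Ideal.mul_mem_left _ _ ?_)
    (Ideal.sum_mem _ fun i _ => Ideal.mul_mem_left _ _ ?_)
  · have : W.submatrix (Fin.succAbove 0) Fin.succ = B := by
      ext i j
      simp [W]
    rw [this, Matrix.det_succ_row_zero]
    exact Ideal.sum_mem _ fun j _ => Ideal.mul_mem_left _ _ (hB 0 j)
  · rw [Matrix.det_succ_row_zero]
    refine Ideal.sum_mem _ fun j _ => Ideal.mul_mem_left _ _ ?_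
    convert hB i j using 2
    ext l p
    simp [W]

/-- The size of the minors grows with the number of generators, which matches the two inclusions
above. If `d` exceeds the number of generators, both truncated differences are 0 and both ideals are
the unit ideal. -/
lemma relationMinors_option (d : ℕ) (x : ι → M) (y : M)
    (hy : y ∈ Submodule.span R (Set.range x)) :
    relationMinors (R := R) (Fintype.card (Option ι) - d) (fun o : Option ι => o.elim y x) =
      relationMinors (Fintype.card ι - d) x := by
  obtain ⟨b, rfl⟩ := (Submodule.mem_span_range_iff_exists_fun R).1 hy
  rw [Fintype.card_option]
  rcases le_or_gt d (Fintype.card ι) with h | h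
  · rw [Nat.sub_add_comm h]
    exact (relationMinors_option_le _ x b).antisymm (relationMinors_le_option _ x b)
  · rw [Nat.sub_eq_zero_of_le h, Nat.sub_eq_zero_of_le h.le, relationMinors_zero,
      relationMinors_zero]

lemma relationMinors_sumElim (d : ℕ) (x : ι → M) (hx : Submodule.span R (Set.range x) = ⊤)
    (κ : Type*) [Fintype κ] (y : κ → M) :
    relationMinors (R := R) (Fintype.card (ι ⊕ κ) - d) (Sum.elim x y) =
      relationMinors (Fintype.card ι - d) x := by
  classical
  -- Redundant generators are added one at a time. The `Fintype` structure is quantified inside the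
  -- claim because the induction principle for finite types supplies none.
  suffices h : ∀ (_ : Fintype κ) (y : κ → M),
      relationMinors (R := R) (Fintype.card (ι ⊕ κ) - d) (Sum.elim x y) =
        relationMinors (Fintype.card ι - d) x from h _ y
  clear! y
  refine Finite.induction_empty_option (P := fun κ : Type _ => ∀ (_ : Fintype κ) (y : κ → M),
    relationMinors (R := R) (Fintype.card (ι ⊕ κ) - d) (Sum.elim x y) =
      relationMinors (Fintype.card ι - d) x) ?_ ?_ ?_ κ
  · intro κ κ' e ih hκ' y
    let _ : Fintype κ := Fintype.ofEquiv _ e.symm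
    rw [← ih _ (y ∘ e)]
    let e' : ι ⊕ κ ≃ ι ⊕ κ' := Equiv.sumCongr (Equiv.refl _) e
    rw [Fintype.card_congr e', ← relationMinors_comp_equiv _ _ e']
    congr 1
    ext (i | i) <;> simp [e']
  · intro _ y
    let e' : ι ≃ ι ⊕ PEmpty := (Equiv.sumEmpty _ _).symm
    rw [← relationMinors_comp_equiv _ _ e', ← Fintype.card_congr e']
    rfl
  · intro κ _ ih h y
    obtain rfl : h = instFintypeOption := Subsingleton.elim _ _
    rw [← ih _ (y ∘ some), ← relationMinors_option d (Sum.elim x (y ∘ some)) (y none)]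
    · let e' : Option (ι ⊕ κ) ≃ ι ⊕ Option κ :=
        ⟨fun o => o.elim (Sum.inr none) (Sum.elim Sum.inl (Sum.inr ∘ some)),
          Sum.elim (some ∘ Sum.inl) fun o => o.elim none (some ∘ Sum.inr),
          by rintro (_ | _ | _) <;> rfl, by rintro (_ | _ | _) <;> rfl⟩
      rw [Fintype.card_congr e', ← relationMinors_comp_equiv _ _ e']
      congr 1
      ext (_ | _ | _) <;> rfl
    · rw [Set.Sum.elim_range, Submodule.span_union, hx, top_sup_eq]
      trivial

/-- Each family, being generating, makes the other redundant, so both ideals agree with the one of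
the concatenated family. -/
lemma relationMinors_eq_of_span_eq_top (d : ℕ) (x : ι → M) (y : κ → M)
    (hx : Submodule.span R (Set.range x) = ⊤) (hy : Submodule.span R (Set.range y) = ⊤) :
    relationMinors (R := R) (Fintype.card ι - d) x = relationMinors (Fintype.card κ - d) y := by
  rw [← relationMinors_sumElim d x hx κ y, ← relationMinors_sumElim d y hy ι x,
    Fintype.card_congr (Equiv.sumComm ι κ), ← relationMinors_comp_equiv _ _ (Equiv.sumComm ι κ)]
  congr 1
  ext (_ | _) <;> rfl

/-- Fitting ideals are computed by any finite generating family. -/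
lemma fittingIdeal_eq (d : ℕ) (x : ι → M) (hx : Submodule.span R (Set.range x) = ⊤) :
    fittingIdeal d R M = relationMinors (Fintype.card ι - d) x := by
  refine le_antisymm (Ideal.span_le.2 ?_) (Ideal.span_le.2 ?_)
  · rintro _ ⟨n, y, A, c, hy, h, rfl⟩
    rw [relationMinors_eq_of_span_eq_top d x y hx hy, Fintype.card_fin]
    exact det_mem_relationMinors A c h
  · rintro _ ⟨A, c, h, rfl⟩
    let e := Fintype.equivFin ι
    refine Ideal.subset_span ⟨Fintype.card ι, x ∘ e.symm, A.submatrix id e.symm, e ∘ c, ?_,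
      fun i => ?_, ?_⟩
    · rw [e.symm.surjective.range_comp, hx]
    · rw [← h i, ← e.symm.sum_comp]
      rfl
    · congr 1
      ext i j
      simp

/-- Fitting ideals commute with localization. -/
lemma fittingIdeal_map_of_isLocalizedModule {R' M' : Type*} [CommRing R'] [Algebra R R']
    [AddCommGroup M'] [Module R' M'] [Module R M'] [IsScalarTower R R' M'] (S : Submonoid R)
    [IsLocalization S R'] (f : M →ₗ[R] M') [IsLocalizedModule S f] [Module.Finite R M] (d : ℕ) :
    (fittingIdeal d R M).map (algebraMap R R') = fittingIdeal d R' M' := by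
  obtain ⟨n, x, hx⟩ := Module.Finite.exists_fin (R := R) (M := M)
  have hfx : Submodule.span R' (Set.range (f ∘ x)) = ⊤ := by
    rw [Set.range_comp]
    exact span_eq_top_of_isLocalizedModule R' S f hx
  rw [fittingIdeal_eq d x hx, fittingIdeal_eq d (f ∘ x) hfx]
  refine le_antisymm (Ideal.map_le_iff_le_comap.2 (Ideal.span_le.2 ?_)) (Ideal.span_le.2 ?_)
  · rintro _ ⟨A, c, h, rfl⟩
    refine Ideal.subset_span ⟨A.map (algebraMap R R'), c, fun i => ?_, ?_⟩
    · rw [← map_zero f, ← h i, map_sum]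
      simp
    · rw [RingHom.map_det]
      rfl
  · rintro _ ⟨B, c, h, rfl⟩
    -- The element s clears the denominators of the relation matrix. The cleared rows are relations
    -- only after applying `f`; a further factor T from `S` makes them relations in `M` itself.
    obtain ⟨s, hs⟩ := IsLocalization.exist_integer_multiples_of_finite S
      (fun p : Fin (Fintype.card (Fin n) - d) × Fin n => B p.1 p.2)
    choose A hA using hs
    have h0 (i) : f (∑ j, A (i, j) • x j) = 0 := by
      rw [map_sum]
      calc _ = s.1 • ∑ j, B i j • (f ∘ x) j := by
            rw [Finset.smul_sum]
            refine Finset.sum_congr rfl fun j _ => ?_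
            rw [map_smul, ← smul_assoc, ← algebraMap_smul R' (A (i, j)), hA]
            rfl
        _ = 0 := by rw [h i, smul_zero]
    have h1 (i) : ∃ t : S, t • (∑ j, A (i, j) • x j) = 0 :=
      (IsLocalizedModule.eq_zero_iff S f).1 (h0 i)
    choose t ht using h1
    let T : S := ∏ i, t i
    have hT (i) : ∑ j, (T.1 * A (i, j)) • x j = 0 := by
      simp only [mul_smul, ← Finset.smul_sum]
      obtain ⟨q, hq⟩ := Finset.dvd_prod_of_mem t (Finset.mem_univ i)
      have : T.1 = q.1 * (t i).1 := by
        rw [mul_comm]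
        exact congrArg Subtype.val hq
      rw [this, mul_smul]
      have := ht i
      rw [Submonoid.smul_def] at this
      rw [this, smul_zero]
    have hm := Ideal.mem_map_of_mem (algebraMap R R') (det_mem_relationMinors (x := x)
      (Matrix.of fun i j => T.1 * A (i, j)) c hT)
    -- The cleared minor and the original one differ by a power of the unit T s of `R'`.
    have he : algebraMap R R' ((Matrix.of fun i j => T.1 * A (i, j)).submatrix id c).det =
        algebraMap R R' (T * s).1 ^ (Fintype.card (Fin n) - d) * (B.submatrix id c).det := by
      have : (Matrix.of fun i j => T.1 * A (i, j)).map (algebraMap R R') =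
          algebraMap R R' (T * s).1 • B := by
        ext i j
        simp only [Matrix.map_apply, Matrix.of_apply, map_mul, Matrix.smul_apply, smul_eq_mul,
          Submonoid.coe_mul, hA, mul_assoc, Algebra.smul_def]
      rw [RingHom.map_det, RingHom.mapMatrix_apply, ← Matrix.submatrix_map, this,
        Matrix.submatrix_smul]
      simp
    rw [he] at hm
    exact (Ideal.unit_mul_mem_iff_mem _ ((IsLocalization.map_units R' (T * s)).pow _)).1 hm

/-- An isomorphism is a localization at the trivial submonoid, so this is a case of compatibility
with localization. -/
lemma fittingIdeal_map_ringEquiv {k A A' : Type*} [CommRing k] [CommRing A] [CommRing A']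
    [Algebra k A] [Algebra k A'] (e : A ≃ₐ[k] A') (d : ℕ) [Module.Finite A (Ω[A⁄k])] :
    (fittingIdeal d A (Ω[A⁄k])).map (e : A →+* A') = fittingIdeal d A' (Ω[A'⁄k]) := by
  let _ : Algebra A A' := (e : A →+* A').toAlgebra
  have : IsScalarTower k A A' := .of_algebraMap_eq fun x => (e.commutes x).symm
  have : IsLocalization (⊥ : Submonoid A) A :=
    IsLocalization.self fun x hx => by rw [Submonoid.mem_bot.1 hx]; exact one_mem _
  have : IsLocalization (⊥ : Submonoid A) A' :=
    IsLocalization.isLocalization_of_algEquiv ⊥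
      (AlgEquiv.ofRingEquiv (f := e.toRingEquiv) fun _ => rfl : A ≃ₐ[A] A')
  exact fittingIdeal_map_of_isLocalizedModule ⊥ (KaehlerDifferential.map k k A A') d

/-- The Fitting ideal of the differentials of a complete intersection is generated by the maximal
minors of the Jacobian matrix. -/
lemma fittingIdeal_quotient {k σ B : Type*} [CommRing k] [Fintype σ] [CommRing B] [Algebra k B]
    [Algebra (MvPolynomial σ k) B] [IsScalarTower k (MvPolynomial σ k) B] {c d : ℕ}
    (hsurj : Function.Surjective (algebraMap (MvPolynomial σ k) B)) (h : Fin c → MvPolynomial σ k)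
    (hI : RingHom.ker (algebraMap (MvPolynomial σ k) B) = Ideal.span (Set.range h))
    (hd : Fintype.card σ = c + d) :
    fittingIdeal d B (Ω[B⁄k]) =
      Ideal.span (Set.range fun s : Fin c → σ => Matrix.det
        (Matrix.of fun i j => algebraMap (MvPolynomial σ k) B (MvPolynomial.pderiv (s j) (h i)))) := by
  classical
  let φ : MvPolynomial σ k →+* B := algebraMap (MvPolynomial σ k) B
  let x : σ → Ω[B⁄k] := fun i => KaehlerDifferential.D k B (φ (MvPolynomial.X i))
  let b : Module.Basis σ (MvPolynomial σ k) Ω[MvPolynomial σ k⁄k] :=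
    KaehlerDifferential.mvPolynomialBasis k σ
  have hb (i) : KaehlerDifferential.map k k (MvPolynomial σ k) B (b i) = x i := by
    simp only [b, x, KaehlerDifferential.mvPolynomialBasis_apply, KaehlerDifferential.map_D, φ]
  let b' : Module.Basis σ B (TensorProduct (MvPolynomial σ k) B Ω[MvPolynomial σ k⁄k]) := b.baseChange B
  have hb' (i) : KaehlerDifferential.mapBaseChange k (MvPolynomial σ k) B (b' i) = x i := by
    simp only [b', Module.Basis.baseChange_apply, KaehlerDifferential.mapBaseChange_tmul, hb,
      one_smul]
  have hD (f : MvPolynomial σ k) : (1 : B) ⊗ₜ[MvPolynomial σ k] KaehlerDifferential.D k (MvPolynomial σ k) f =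
      ∑ j, φ (MvPolynomial.pderiv j f) • b' j := by
    conv_lhs => rw [← b.sum_repr (KaehlerDifferential.D k (MvPolynomial σ k) f)]
    rw [TensorProduct.tmul_sum]
    refine Finset.sum_congr rfl fun j _ => ?_
    rw [TensorProduct.tmul_smul, Module.Basis.baseChange_apply, algebraMap_smul,
      KaehlerDifferential.mvPolynomialBasis_repr_apply]
  have hx : Submodule.span B (Set.range x) = ⊤ := by
    have : x = KaehlerDifferential.mapBaseChange k (MvPolynomial σ k) B ∘ b' := funext fun i => (hb' i).symm
    rw [this, Set.range_comp, ← Submodule.map_span, b'.span_eq, Submodule.map_top,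
      LinearMap.range_eq_top]
    exact KaehlerDifferential.mapBaseChange_surjective k (MvPolynomial σ k) B hsurj
  have hrel (i) : ∑ j, φ (MvPolynomial.pderiv j (h i)) • x j = 0 := by
    have := congrArg (KaehlerDifferential.mapBaseChange k (MvPolynomial σ k) B) (hD (h i))
    simp only [map_sum, map_smul, hb', KaehlerDifferential.mapBaseChange_tmul, one_smul,
      KaehlerDifferential.map_D] at this
    rw [← this, show algebraMap (MvPolynomial σ k) B (h i) = 0 from ?_, map_zero]
    rw [← RingHom.mem_ker, hI]
    exact Ideal.subset_span ⟨i, rfl⟩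
  -- By exactness of I/I² → B ⊗ Ω → Ω_B → 0, a relation between the dx_j comes from df for some f in
  -- I. Writing f = Σ q_i h_i, the Leibniz terms h_i dq_i vanish over B, so the relation is a
  -- combination of the rows of the Jacobian matrix.
  have hrow (a : σ → B) (ha : ∑ j, a j • x j = 0) : ∃ s : Fin c → B, ∀ j,
      a j = ∑ i, s i * φ (MvPolynomial.pderiv j (h i)) := by
    have h0 : KaehlerDifferential.mapBaseChange k (MvPolynomial σ k) B (∑ j, a j • b' j) = 0 := by
      simp only [map_sum, map_smul, hb', ha]
    obtain ⟨y, hy⟩ := (KaehlerDifferential.exact_kerCotangentToTensor_mapBaseChange k (MvPolynomial σ k) B hsurj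
      _).1 h0
    obtain ⟨⟨f, hf⟩, rfl⟩ := Ideal.toCotangent_surjective _ y
    rw [KaehlerDifferential.kerCotangentToTensor_toCotangent, hD] at hy
    have hj (j) : a j = φ (MvPolynomial.pderiv j f) := by
      have := congrArg (fun z => b'.repr z j) hy
      rw [b'.repr_sum_self, b'.repr_sum_self] at this
      exact this.symm
    rw [hI] at hf
    obtain ⟨q, rfl⟩ := (Ideal.mem_span_range_iff_exists_fun).1 hf
    refine ⟨fun i => φ (q i), fun j => ?_⟩
    rw [hj, map_sum, map_sum]
    refine Finset.sum_congr rfl fun i _ => ?_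
    have h0 : φ (h i) = 0 := by
      rw [← RingHom.mem_ker, hI]
      exact Ideal.subset_span ⟨i, rfl⟩
    rw [Derivation.leibniz, map_add, smul_eq_mul, smul_eq_mul, map_mul, map_mul, h0, zero_mul,
      add_zero]
  rw [fittingIdeal_eq d x hx, hd, Nat.add_sub_cancel]
  refine le_antisymm (Ideal.span_le.2 ?_) (Ideal.span_le.2 ?_)
  · rintro _ ⟨A, s, hA, rfl⟩
    choose t ht using fun i => hrow (A i) (hA i)
    have : A.submatrix id s = Matrix.of t *
        Matrix.of fun i j => φ (MvPolynomial.pderiv (s j) (h i)) := by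
      ext i j
      simp [Matrix.mul_apply, ht]
    rw [this, Matrix.det_mul]
    exact Ideal.mul_mem_left _ _ (Ideal.subset_span ⟨s, rfl⟩)
  · rintro _ ⟨s, rfl⟩
    exact det_mem_relationMinors (Matrix.of fun i j => φ (MvPolynomial.pderiv j (h i)))
      s hrel

end fitting

/-! ### Dimension of a complete intersection in affine space. -/

section dimension

/-- Induction on the number of variables: over a Jacobson ring A, a maximal ideal of A[X] contracts
to a maximal ideal of A, and the height grows by exactly one. -/
lemma height_eq_of_isMaximal_mvPolynomial {k : Type*} [Field k] (N : ℕ)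
    (p : Ideal (MvPolynomial (Fin N) k)) [p.IsMaximal] : p.height = N := by
  induction N with
  | zero =>
    have e : MvPolynomial (Fin 0) k ≃+* k := MvPolynomial.isEmptyRingEquiv k (Fin 0)
    rw [← e.height_map]
    have : (p.map e).IsMaximal := Ideal.map_isMaximal_of_equiv e
    rw [Ideal.eq_bot_of_prime (p.map e)]
    simp
  | succ N ih =>
    let e : MvPolynomial (Fin (N + 1)) k ≃+* (MvPolynomial (Fin N) k)[X] :=
      (MvPolynomial.finSuccEquiv k N).toRingEquiv
    rw [← e.height_map]
    have : (p.map e).IsMaximal := Ideal.map_isMaximal_of_equiv e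
    generalize p.map e = q at this ⊢
    let q' : Ideal (MvPolynomial (Fin N) k) := q.comap C
    have hq' : q'.IsMaximal := Polynomial.isMaximal_comap_C_of_isJacobsonRing q
    have hq : q.LiesOver q' := ⟨rfl⟩
    rw [Polynomial.height_eq_height_add_one q' q, ih]
    simp

/-- Dividing by a nonzerodivisor lowers the dimension by at least one. The induction appends at the
end, so that the last element is regular on the quotient by the previous ones. -/
lemma ringKrullDim_add_length_le {R : Type*} [CommRing R] (l : List R)
    (h : RingTheory.Sequence.IsWeaklyRegular R l) :
    ringKrullDim (R ⧸ Ideal.ofList l) + l.length ≤ ringKrullDim R := by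
  induction l using List.reverseRecOn with
  | nil =>
    rw [Ideal.ofList_nil, ringKrullDim_eq_of_ringEquiv (RingEquiv.quotientBot R)]
    simp
  | append_singleton l r ih =>
    rw [RingTheory.Sequence.isWeaklyRegular_append_iff,
      RingTheory.Sequence.isWeaklyRegular_singleton_iff] at h
    refine le_trans ?_ (ih h.1)
    have hr : Ideal.Quotient.mk (Ideal.ofList l) r ∈ nonZeroDivisors (R ⧸ Ideal.ofList l) := by
      have h2 := h.2
      rw [smul_eq_mul, Ideal.mul_top] at h2
      rw [mem_nonZeroDivisors_iff_right]
      intro z hz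
      apply h2
      obtain ⟨z, rfl⟩ := Ideal.Quotient.mk_surjective z
      simp only [smul_zero]
      rw [mul_comm] at hz
      exact hz
    have := ringKrullDim_quotient_succ_le_of_nonZeroDivisor hr
    have e : ((R ⧸ Ideal.ofList l) ⧸ Ideal.span {Ideal.Quotient.mk (Ideal.ofList l) r}) ≃+*
        R ⧸ Ideal.ofList (l ++ [r]) :=
      (Ideal.quotEquivOfEq (by rw [Ideal.map_span, Set.image_singleton])).trans
        ((DoubleQuot.quotQuotEquivQuotSup (Ideal.ofList l) (Ideal.span {r})).trans
          (Ideal.quotEquivOfEq (by rw [Ideal.ofList_append, Ideal.ofList_singleton])))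
    rw [ringKrullDim_eq_of_ringEquiv e] at this
    refine le_trans ?_ (add_le_add_left this _)
    rw [List.length_append, List.length_singleton, Nat.cast_add, add_assoc, add_comm 1, Nat.cast_one]

/-- One inequality holds because each member of the sequence lowers the dimension. The other is
Krull's height theorem at a maximal ideal containing the sequence, which exists by regularity and
has height N. -/
lemma ringKrullDim_quotient_ofList {k : Type*} [Field k] {N : ℕ}
    (l : List (MvPolynomial (Fin N) k))
    (h : RingTheory.Sequence.IsRegular (MvPolynomial (Fin N) k) l) :
    ringKrullDim (MvPolynomial (Fin N) k ⧸ Ideal.ofList l) + l.length = N := by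
  refine le_antisymm ?_ ?_
  · refine (ringKrullDim_add_length_le l h.1).trans ?_
    simp
  · have hne : Ideal.ofList l ≠ ⊤ := by
      have := h.2
      intro h'
      rw [h'] at this
      simp at this
    obtain ⟨p, hp, hlp⟩ := Ideal.exists_le_maximal _ hne
    have := Ideal.height_le_ringKrullDim_quotient_add_encard (p := p) {x | x ∈ l}
      (fun x hx => hlp (Ideal.subset_span hx))
    rw [height_eq_of_isMaximal_mvPolynomial] at this
    refine (le_trans (by simp) this).trans ?_
    gcongr
    classical
    have hl : {x | x ∈ l} = (l.toFinset : Set _) := by ext; simp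
    rw [hl, Set.encard_coe_eq_coe_finsetCard]
    exact_mod_cast l.toFinset_card_le

end dimension

/-! ### Normal forms of matrices over k⟦X⟧. -/

section normalForm

lemma exists_unit_mul_X_pow {k : Type*} [Field k] {f : PowerSeries k} (hf : f ≠ 0) :
    ∃ u : (PowerSeries k)ˣ, f = (u : PowerSeries k) * PowerSeries.X ^ f.order.toNat := by
  refine ⟨PowerSeries.Unit_of_divided_by_X_pow_order f, ?_⟩
  rw [PowerSeries.Unit_of_divided_by_X_pow_order_nonzero hf, mul_comm,
    PowerSeries.X_pow_order_mul_divXPowOrder]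

/-- Smith normal form of a square matrix with nonzero determinant. -/
lemma exists_smith_of_det_ne_zero {R ι : Type*} [CommRing R] [IsDomain R] [IsPrincipalIdealRing R]
    [Fintype ι] [DecidableEq ι] (A : Matrix ι ι R) (hA : A.det ≠ 0) :
    ∃ (W V : Matrix ι ι R) (a : ι → R), IsUnit W ∧ IsUnit V ∧ A * V = W * Matrix.diagonal a := by
  have hinj : Function.Injective A.mulVecLin := Matrix.mulVec_injective_of_det_ne_zero hA
  let eA := LinearEquiv.ofInjective A.mulVecLin hinj
  -- The image of A has full rank by injectivity, so there are stacked bases: `b` of the whole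
  -- module and `b'` of the image, with b'_j = a_j b_j. The columns of W are the `b`, those of V the
  -- preimages of the `b'`.
  obtain ⟨b, a, b', hb⟩ := Submodule.exists_smith_normal_form_of_rank_eq
    (N := LinearMap.range A.mulVecLin) (Pi.basisFun R ι) eA.finrank_eq.symm
  let v := b'.map eA.symm
  refine ⟨(Pi.basisFun R ι).toMatrix b, (Pi.basisFun R ι).toMatrix v, a, ?_, ?_, ?_⟩
  · have := (Pi.basisFun R ι).invertibleToMatrix b
    exact isUnit_of_invertible _
  · have := (Pi.basisFun R ι).invertibleToMatrix v
    exact isUnit_of_invertible _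
  · ext i j
    have h1 : A.mulVec (v j) = a j • b j := by
      rw [← hb]
      change A.mulVecLin (eA.symm (b' j)) = _
      rw [← LinearEquiv.ofInjective_apply (h := hinj)]
      change ((eA (eA.symm (b' j)) : LinearMap.range A.mulVecLin) : ι → R) = _
      rw [LinearEquiv.apply_symm_apply]
    have h2 := congrFun h1 i
    rw [Matrix.mul_diagonal, Module.Basis.toMatrix_apply, Pi.basisFun_repr, mul_comm]
    exact h2

/-- A square matrix over `k⟦X⟧` whose determinant has order `e` is equivalent to a diagonal
matrix of powers of `X`. -/
lemma exists_diagonal_X_pow {k ι : Type*} [Field k] [Fintype ι] [DecidableEq ι] {e : ℕ}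
    (A : Matrix ι ι (PowerSeries k)) (hA : A.det.order = e) :
    ∃ (U V : Matrix ι ι (PowerSeries k)) (ε : ι → ℕ), IsUnit U ∧ IsUnit V ∧ ∑ i, ε i = e ∧
      U * A * V = Matrix.diagonal fun i => PowerSeries.X ^ ε i := by
  have h0 : A.det ≠ 0 := by
    rintro h
    rw [h, PowerSeries.order_zero] at hA
    exact ENat.top_ne_natCast _ hA
  obtain ⟨W, V, a, hW, hV, h⟩ := exists_smith_of_det_ne_zero A h0
  have hW' := (Matrix.isUnit_iff_isUnit_det _).1 hW
  have hV' := (Matrix.isUnit_iff_isUnit_det _).1 hV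
  have hdet := congrArg Matrix.det h
  rw [Matrix.det_mul, Matrix.det_mul, Matrix.det_diagonal] at hdet
  have ha (i) : a i ≠ 0 := by
    intro hi
    rw [Finset.prod_eq_zero (Finset.mem_univ i) hi, mul_zero] at hdet
    exact mul_ne_zero h0 hV'.ne_zero hdet
  choose u hu using fun i => exists_unit_mul_X_pow (ha i)
  -- The unit parts of the invariant factors are absorbed into the row operations.
  let D : Matrix ι ι (PowerSeries k) := Matrix.diagonal fun i => ((u i)⁻¹ : (PowerSeries k)ˣ)
  have hD : IsUnit D := by
    rw [Matrix.isUnit_iff_isUnit_det, Matrix.det_diagonal]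
    rw [← Units.coe_prod]
    exact Units.isUnit _
  refine ⟨D * W⁻¹, V, fun i => (a i).order.toNat, hD.mul ?_, hV, ?_, ?_⟩
  · exact (Matrix.isUnit_nonsing_inv_iff).2 hW
  · have := congrArg PowerSeries.order hdet
    rw [PowerSeries.order_mul, PowerSeries.order_mul, hA, PowerSeries.order_zero_of_unit hW',
      PowerSeries.order_zero_of_unit hV', add_zero, zero_add, PowerSeries.order_prod] at this
    rw [← Nat.cast_inj (R := ℕ∞), this, Nat.cast_sum]
    exact Finset.sum_congr rfl fun i _ => PowerSeries.coe_toNat_order (ha i)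
  · rw [Matrix.mul_assoc, Matrix.mul_assoc, h, ← Matrix.mul_assoc W⁻¹,
      Matrix.nonsing_inv_mul _ hW', Matrix.one_mul, Matrix.diagonal_mul_diagonal]
    congr 1
    ext1 i
    conv_lhs => rw [hu i]
    rw [← mul_assoc, Units.inv_mul, one_mul]

/-- If some maximal minor of `J` divides all of them, then the columns of `J` outside this minor
can be cleared by column operations. -/
lemma exists_mul_eq_fromCols_zero {R σ : Type*} [CommRing R] [IsDomain R] [Fintype σ] [DecidableEq σ]
    {c : ℕ} (J : Matrix (Fin c) σ R) (s : Fin c → σ) (hs : (J.submatrix id s).det ≠ 0)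
    (h : ∀ s' : Fin c → σ, (J.submatrix id s).det ∣ (J.submatrix id s').det) :
    ∃ (κ : Type) (_ : Fintype κ) (_ : DecidableEq κ) (P : Matrix σ (Fin c ⊕ κ) R)
      (P' : Matrix (Fin c ⊕ κ) σ R), P * P' = 1 ∧ P' * P = 1 ∧
      J * P = Matrix.fromCols (J.submatrix id s) 0 := by
  have hinj : Function.Injective s := by
    intro i j hij
    by_contra hne
    exact hs (Matrix.det_zero_of_column_eq hne fun l => by simp [hij])
  -- Numbering the remaining columns by `Fin` puts κ in `Type`, whatever the universe of σ.
  let κ := Fin (Fintype.card {i // i ∉ Set.range s})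
  let τ : Fin c ⊕ κ ≃ σ := (Equiv.sumCongr (Equiv.ofInjective s hinj)
    (Fintype.equivFin {i // i ∉ Set.range s}).symm).trans (Equiv.sumCompl (· ∈ Set.range s))
  have hτ (i) : τ (Sum.inl i) = s i := by
    exact Equiv.sumCompl_apply_inl _
  let A := J.submatrix id s
  let B : Matrix (Fin c) κ R := J.submatrix id (τ ∘ Sum.inr)
  have hJ : J.submatrix id τ = Matrix.fromCols A B := by
    ext i (j | j)
    · simp [A, hτ]
    · simp [B]
  -- By Cramer's rule this entry is the maximal minor of J with the i-th chosen column replaced by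
  -- the j-th remaining one. Hence A⁻¹ B, a priori over the fraction field, has entries in R; it is
  -- the matrix `E` below.
  have hdvd (i j) : A.det ∣ (A.adjugate * B) i j := by
    have : (A.adjugate * B) i j = (J.submatrix id (Function.update s i (τ (Sum.inr j)))).det := by
      rw [Matrix.mul_apply]
      change A.adjugate.mulVec (fun l => B l j) i = _
      rw [← Matrix.cramer_eq_adjugate_mulVec, Matrix.cramer_apply]
      congr 1
      ext p q
      by_cases hq : q = i
      · subst hq
        simp [B]
      · simp [A, hq]
    rw [this]
    exact h _
  choose E hE using hdvd
  let E : Matrix (Fin c) κ R := Matrix.of E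
  have hAE : A * E = B := by
    have h1 : A.adjugate * B = A.det • E := by
      ext i j
      simp [hE, E]
    have h2 : A.det • B = A.det • (A * E) := by
      rw [← Matrix.mul_smul, ← h1, ← Matrix.mul_assoc, Matrix.mul_adjugate, Matrix.smul_mul,
        Matrix.one_mul]
    exact (smul_right_injective _ hs h2).symm
  let Q : Matrix (Fin c ⊕ κ) (Fin c ⊕ κ) R := Matrix.fromBlocks 1 (-E) 0 1
  let Q' : Matrix (Fin c ⊕ κ) (Fin c ⊕ κ) R := Matrix.fromBlocks 1 E 0 1
  have hQ : Q * Q' = 1 := by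
    simp [Q, Q', Matrix.fromBlocks_multiply, ← Matrix.fromBlocks_one]
  have hQ' : Q' * Q = 1 := by
    simp [Q, Q', Matrix.fromBlocks_multiply, ← Matrix.fromBlocks_one]
  let P : Matrix σ (Fin c ⊕ κ) R := Q.submatrix τ.symm (Equiv.refl _)
  let P' : Matrix (Fin c ⊕ κ) σ R := Q'.submatrix (Equiv.refl _) τ.symm
  refine ⟨κ, inferInstance, inferInstance, P, P', ?_, ?_, ?_⟩
  · rw [Matrix.submatrix_mul_equiv, hQ, Matrix.submatrix_one_equiv]
  · rw [Matrix.submatrix_mul_equiv, hQ', Matrix.submatrix_one_equiv]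
  · have hJ' : J = (Matrix.fromCols A B).submatrix (Equiv.refl _) τ.symm := by
      rw [← hJ]
      ext i j
      simp
    conv_lhs => rw [hJ', Matrix.submatrix_mul_equiv]
    simp only [Q, Matrix.fromCols_mul_fromBlocks, Matrix.mul_neg, hAE]
    simp [A]

/-- Normal form of a `c × N` matrix over `k⟦X⟧` whose ideal of maximal minors is generated by
`X ^ e`. -/
lemma exists_normalForm {k σ : Type*} [Field k] [Fintype σ] [DecidableEq σ] {c e : ℕ}
    (J : Matrix (Fin c) σ (PowerSeries k)) (s : Fin c → σ)
    (hs : (J.submatrix id s).det.order = e)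
    (h : ∀ s' : Fin c → σ, (e : ℕ∞) ≤ (J.submatrix id s').det.order) :
    ∃ (κ : Type) (_ : Fintype κ) (_ : DecidableEq κ) (P : Matrix σ (Fin c ⊕ κ) (PowerSeries k))
      (P' : Matrix (Fin c ⊕ κ) σ (PowerSeries k)) (U U' : Matrix (Fin c) (Fin c) (PowerSeries k))
      (ε : Fin c → ℕ), c + Fintype.card κ = Fintype.card σ ∧ P * P' = 1 ∧ P' * P = 1 ∧
      U' * U = 1 ∧ ∑ i, ε i = e ∧
      U * J * P = Matrix.fromCols (Matrix.diagonal fun i => PowerSeries.X ^ ε i) 0 := by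
  have h0 : (J.submatrix id s).det ≠ 0 := by
    rintro h
    rw [h, PowerSeries.order_zero] at hs
    exact ENat.top_ne_natCast _ hs
  -- Divisibility in k⟦X⟧ is comparison of orders, so the minor of order e divides every other one.
  obtain ⟨κ, _, _, P, P', hPP', hP'P, hJ⟩ := exists_mul_eq_fromCols_zero J s h0 (fun s' => by
    obtain ⟨u, hu⟩ := exists_unit_mul_X_pow h0
    rw [hu, Units.mul_left_dvd, PowerSeries.X_pow_dvd_iff]
    intro i hi
    apply PowerSeries.coeff_of_lt_order
    rw [hs, ENat.toNat_natCast] at hi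
    exact lt_of_lt_of_le (by exact_mod_cast hi) (h s'))
  obtain ⟨U, V, ε, hU, hV, hε, hD⟩ := exists_diagonal_X_pow _ hs
  rw [Matrix.isUnit_iff_isUnit_det] at hU hV
  let Q : Matrix (Fin c ⊕ κ) (Fin c ⊕ κ) (PowerSeries k) := Matrix.fromBlocks V 0 0 1
  let Q' : Matrix (Fin c ⊕ κ) (Fin c ⊕ κ) (PowerSeries k) := Matrix.fromBlocks V⁻¹ 0 0 1
  have hQ : Q * Q' = 1 := by
    simp only [Q, Q', Matrix.fromBlocks_multiply]
    simp [Matrix.mul_nonsing_inv _ hV, Matrix.fromBlocks_one]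
  have hQ' : Q' * Q = 1 := by
    simp only [Q, Q', Matrix.fromBlocks_multiply]
    simp [Matrix.nonsing_inv_mul _ hV, Matrix.fromBlocks_one]
  refine ⟨κ, inferInstance, inferInstance, P * Q, Q' * P', U, U⁻¹, ε, ?_, ?_, ?_,
    Matrix.nonsing_inv_mul _ hU, hε, ?_⟩
  · have := Matrix.square_of_invertible P P' hPP' hP'P
    simpa using this.symm
  · rw [Matrix.mul_assoc, ← Matrix.mul_assoc Q, hQ, Matrix.one_mul, hPP']
  · rw [Matrix.mul_assoc, ← Matrix.mul_assoc P', hP'P, Matrix.one_mul, hQ']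
  · rw [← Matrix.mul_assoc, Matrix.mul_assoc U J P, hJ, ← hD, Matrix.mul_fromCols,
      Matrix.fromCols_mul_fromBlocks]
    simp

end normalForm

/-! ### A fixed point principle for truncated power series. -/

section contraction

variable {R τ : Type*} [CommRing R]

/-- Families of power series which agree up to order `j`. -/
def AgreeUpTo (j : ℕ) (w w' : τ → PowerSeries R) : Prop :=
  ∀ a, ∀ l < j, PowerSeries.coeff l (w a) = PowerSeries.coeff l (w' a)

lemma agreeUpTo_iff {j : ℕ} {w w' : τ → PowerSeries R} :
    AgreeUpTo j w w' ↔ ∀ a, PowerSeries.X ^ j ∣ w a - w' a := by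
  simp only [AgreeUpTo, PowerSeries.X_pow_dvd_iff, map_sub, sub_eq_zero]

/-- All coefficients in degrees at least `L` vanish. -/
def IsTruncated (L : ℕ) (w : τ → PowerSeries R) : Prop :=
  ∀ a, ∀ l, L ≤ l → PowerSeries.coeff l (w a) = 0

lemma AgreeUpTo.eq {L : ℕ} {w w' : τ → PowerSeries R} (h : AgreeUpTo L w w')
    (hw : IsTruncated L w) (hw' : IsTruncated L w') : w = w' := by
  ext a l
  rcases lt_or_ge l L with hl | hl
  · exact h a l hl
  · rw [hw a l hl, hw' a l hl]

/-- Φ is a contraction for the X-adic topology: each iteration fixes one more coefficient. As the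
values have no coefficients from degree L on, finitely many iterations reach the fixed point. -/
lemma existsUnique_fixedPoint {L : ℕ} (Φ : (τ → PowerSeries R) → τ → PowerSeries R)
    (hL : ∀ w, IsTruncated L (Φ w))
    (hΦ : ∀ j w w', AgreeUpTo j w w' → AgreeUpTo (j + 1) (Φ w) (Φ w')) :
    ∃! w, Φ w = w := by
  have h (w) (j : ℕ) : AgreeUpTo j (Φ^[j] w) (Φ^[j] (Φ w)) := by
    induction j with
    | zero => exact fun a l hl => absurd hl (Nat.not_lt_zero _)
    | succ j ih =>
      rw [Function.iterate_succ_apply', Function.iterate_succ_apply']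
      exact hΦ j _ _ ih
  -- After L iterations the coefficients below L are stable. One further application makes the
  -- candidate a value of Φ, hence truncated.
  refine ⟨Φ (Φ^[L] 0), ?_, fun w hw => ?_⟩
  · refine AgreeUpTo.eq (L := L) (fun a l hl => ?_) (hL _) (hL _)
    have := hΦ L _ _ (h 0 L) a l (by omega)
    rw [← Function.iterate_succ_apply, Function.iterate_succ_apply'] at this
    exact this.symm
  · have key (j : ℕ) : AgreeUpTo j w (Φ^[j] (Φ 0)) := by
      induction j with
      | zero => exact fun a l hl => absurd hl (Nat.not_lt_zero _)
      | succ j ih =>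
        rw [Function.iterate_succ_apply']
        have := hΦ j _ _ ih
        rwa [hw] at this
    have hw' := hL w
    rw [hw] at hw'
    refine AgreeUpTo.eq (key L) hw' ?_ |>.trans ?_
    · rw [← Function.iterate_succ_apply, Function.iterate_succ_apply']
      exact hL _
    · rw [← Function.iterate_succ_apply, Function.iterate_succ_apply']

end contraction

/-! ### The triangular system and its free coefficients. -/

section triangular

variable {k R R' κ : Type*} [CommRing k] [CommRing R] [CommRing R'] {c : ℕ}

/-- The index set of the free coefficients of the triangular system `IsTriangularSolution`. -/
abbrev FreeIndex (κ : Type*) {c : ℕ} (ε : Fin c → ℕ) (L : ℕ) : Type _ :=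
  (Σ i : Fin c, Fin (ε i)) ⊕ κ × Fin L

lemma card_freeIndex [Fintype κ] (ε : Fin c → ℕ) (L : ℕ) :
    Fintype.card (FreeIndex κ ε L) = L * Fintype.card κ + ∑ i, ε i := by
  simp [add_comm, mul_comm]

/-- The free coefficients. -/
def freeCoeff (ε : Fin c → ℕ) (L : ℕ) (w : Fin c ⊕ κ → PowerSeries R) : FreeIndex κ ε L → R
  | Sum.inl p => PowerSeries.coeff (L - ε p.1 + p.2) (w (Sum.inl p.1))
  | Sum.inr p => PowerSeries.coeff p.2 (w (Sum.inr p.1))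

/-- Evaluation of a polynomial over `k⟦X⟧` at power series over a `k`-algebra. -/
abbrev evalSeries {τ : Type*} (ρ : k →+* R) (w : τ → PowerSeries R) :
    MvPolynomial τ (PowerSeries k) →+* PowerSeries R :=
  MvPolynomial.eval₂Hom (PowerSeries.map ρ) w

/-- Modulo X^j the two evaluations are ring homomorphisms with the same values on constants and
variables. -/
lemma AgreeUpTo.evalSeries {τ : Type*} {ρ : k →+* R} {w w' : τ → PowerSeries R} {j : ℕ}
    (h : AgreeUpTo j w w') (q : MvPolynomial τ (PowerSeries k)) :
    PowerSeries.X ^ j ∣ evalSeries ρ w q - evalSeries ρ w' q := by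
  rw [agreeUpTo_iff] at h
  rw [← Ideal.mem_span_singleton, ← Ideal.Quotient.eq, ← RingHom.comp_apply, ← RingHom.comp_apply]
  congr 1
  refine MvPolynomial.ringHom_ext (fun r => by simp) fun a => ?_
  simp only [RingHom.comp_apply, MvPolynomial.coe_eval₂Hom, MvPolynomial.eval₂_X]
  rw [Ideal.Quotient.eq, Ideal.mem_span_singleton]
  exact h a

/-- Solutions of `X ^ ε i * w i + X ^ (n + 1) * q i w = 0` modulo `X ^ L`. -/
def IsTriangularSolution (ε : Fin c → ℕ) (L n : ℕ)
    (q : Fin c → MvPolynomial (Fin c ⊕ κ) (PowerSeries k)) (ρ : k →+* R)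
    (w : Fin c ⊕ κ → PowerSeries R) : Prop :=
  ∀ i, PowerSeries.X ^ L ∣
    PowerSeries.X ^ ε i * w (Sum.inl i) + PowerSeries.X ^ (n + 1) * evalSeries ρ w (q i)

lemma X_pow_mul_dvd_X_pow_mul {a b : ℕ} {f : PowerSeries R} :
    PowerSeries.X ^ (a + b) ∣ PowerSeries.X ^ a * f ↔ PowerSeries.X ^ b ∣ f := by
  simp only [PowerSeries.X_pow_dvd_iff]
  constructor
  · intro h i hi
    have := h (i + a) (by omega)
    rwa [PowerSeries.coeff_X_pow_mul] at this
  · intro h i hi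
    rw [PowerSeries.coeff_X_pow_mul']
    split_ifs with hai
    · exact h _ (by omega)
    · rfl

/-- The self-map whose fixed points are the solutions with prescribed free coefficients. -/
def triangularMap (ε : Fin c → ℕ) (L n : ℕ)
    (q : Fin c → MvPolynomial (Fin c ⊕ κ) (PowerSeries k)) (ρ : k →+* R)
    (p : FreeIndex κ ε L → R) (w : Fin c ⊕ κ → PowerSeries R) : Fin c ⊕ κ → PowerSeries R
  | Sum.inl i => PowerSeries.mk fun j =>
      if j < L - ε i then
        - PowerSeries.coeff j (PowerSeries.X ^ (n + 1 - ε i) * evalSeries ρ w (q i))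
      else if h : j - (L - ε i) < ε i then p (Sum.inl ⟨i, ⟨j - (L - ε i), h⟩⟩) else 0
  | Sum.inr b => PowerSeries.mk fun j => if h : j < L then p (Sum.inr (b, ⟨j, h⟩)) else 0

variable {ε : Fin c → ℕ} {L n : ℕ} {q : Fin c → MvPolynomial (Fin c ⊕ κ) (PowerSeries k)}

/-- Since ε_i is at most L and n, equation i can be divided by X^{ε_i}; it then prescribes the
coefficients of w_i below L - ε_i. The next ε_i coefficients are free, and the default value 0
beyond them expresses truncation at L. -/
lemma triangularMap_eq_iff (hL : ∀ i, ε i ≤ L) (hn : ∀ i, ε i ≤ n) (ρ : k →+* R)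
    (p : FreeIndex κ ε L → R) (w : Fin c ⊕ κ → PowerSeries R) :
    triangularMap ε L n q ρ p w = w ↔
      IsTruncated L w ∧ IsTriangularSolution ε L n q ρ w ∧ freeCoeff ε L w = p := by
  have hsol : IsTriangularSolution ε L n q ρ w ↔ ∀ i, ∀ j < L - ε i,
      PowerSeries.coeff j (w (Sum.inl i)) =
        - PowerSeries.coeff j (PowerSeries.X ^ (n + 1 - ε i) * evalSeries ρ w (q i)) := by
    refine forall_congr' fun i => ?_
    have h1 : n + 1 = ε i + (n + 1 - ε i) := by have := hn i; omega
    have h2 : L = ε i + (L - ε i) := by have := hL i; omega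
    conv_lhs => rw [h1, h2, pow_add PowerSeries.X (ε i) (n + 1 - ε i), mul_assoc, ← mul_add,
      X_pow_mul_dvd_X_pow_mul, PowerSeries.X_pow_dvd_iff]
    simp only [map_add, add_eq_zero_iff_eq_neg]
  rw [hsol]
  constructor
  · intro h
    have hl (i j) := congrArg (PowerSeries.coeff j) (congrFun h (Sum.inl i))
    have hr (b j) := congrArg (PowerSeries.coeff j) (congrFun h (Sum.inr b))
    simp only [triangularMap, PowerSeries.coeff_mk] at hl hr
    refine ⟨?_, ?_, ?_⟩
    · rintro (i | b) l hl'
      · rw [← hl, if_neg (by have := hL i; omega), dif_neg (by have := hL i; omega)]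
      · rw [← hr, dif_neg (by omega)]
    · intro i j hj
      rw [← hl, if_pos hj]
    · ext (⟨i, j⟩ | ⟨b, j⟩)
      · simp only [freeCoeff]
        rw [← hl, if_neg (by omega), dif_pos (by omega)]
        congr
        simp
      · simp only [freeCoeff]
        rw [← hr, dif_pos j.2]
  · rintro ⟨h1, h2, rfl⟩
    ext (i | b) j
    · simp only [triangularMap, PowerSeries.coeff_mk]
      split_ifs with h3 h4
      · rw [h2 i j h3]
      · simp only [freeCoeff]
        congr 2
        omega
      · rw [h1]
        have := hL i
        omega
    · simp only [triangularMap, PowerSeries.coeff_mk]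
      split_ifs with h3
      · rfl
      · rw [h1]
        omega

/-- The solutions of the triangular system are parametrized by their free coefficients. -/
lemma existsUnique_isTriangularSolution (hL : ∀ i, ε i ≤ L) (hn : ∀ i, ε i ≤ n) (ρ : k →+* R)
    (p : FreeIndex κ ε L → R) :
    ∃! w : Fin c ⊕ κ → PowerSeries R,
      IsTruncated L w ∧ IsTriangularSolution ε L n q ρ w ∧ freeCoeff ε L w = p := by
  simp only [← triangularMap_eq_iff hL hn ρ p]
  refine existsUnique_fixedPoint (L := L) _ ?_ ?_
  · rintro w (i | b) l hl
    · simp only [triangularMap, PowerSeries.coeff_mk]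
      rw [if_neg (by have := hL i; omega), dif_neg (by have := hL i; omega)]
    · simp only [triangularMap, PowerSeries.coeff_mk]
      rw [dif_neg (by omega)]
  · rintro j w w' h (i | b) l hl
    · simp only [triangularMap, PowerSeries.coeff_mk]
      split_ifs
      -- The contraction comes from the factor X^{n+1-ε_i}: its exponent is at least 1, so agreement
      -- up to j improves to j + 1.
      · rw [neg_inj, ← sub_eq_zero, ← map_sub, ← mul_sub]
        have h1 := mul_dvd_mul (dvd_refl (PowerSeries.X ^ (n + 1 - ε i))) (h.evalSeries (ρ := ρ) (q i))
        rw [← pow_add, PowerSeries.X_pow_dvd_iff] at h1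
        exact h1 l (by have := hn i; omega)
      · rfl
      · rfl
    · rfl

lemma evalSeries_map {τ : Type*} {ρ : k →+* R} (φ : R →+* R') (w : τ → PowerSeries R)
    (f : MvPolynomial τ (PowerSeries k)) :
    evalSeries (φ.comp ρ) (fun a => PowerSeries.map φ (w a)) f =
      PowerSeries.map φ (evalSeries ρ w f) := by
  rw [← RingHom.comp_apply]
  congr 1
  refine MvPolynomial.ringHom_ext (fun r => ?_) fun a => by simp
  ext
  simp

/-- Base change of solutions allows the one over a polynomial ring to be specialised, in
`exists_universal_isJetLift`. -/
lemma IsTriangularSolution.map {ρ : k →+* R} {w : Fin c ⊕ κ → PowerSeries R}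
    (h : IsTriangularSolution ε L n q ρ w) (φ : R →+* R') :
    IsTriangularSolution ε L n q (φ.comp ρ) fun a => PowerSeries.map φ (w a) := by
  intro i
  have := map_dvd (PowerSeries.map φ) (h i)
  rw [evalSeries_map]
  simpa using this

lemma IsTruncated.map {τ : Type*} {w : τ → PowerSeries R} (h : IsTruncated L w) (φ : R →+* R') :
    IsTruncated L fun a => PowerSeries.map φ (w a) := by
  intro a l hl
  rw [PowerSeries.coeff_map, h a l hl, map_zero]

lemma freeCoeff_map (φ : R →+* R') (w : Fin c ⊕ κ → PowerSeries R) :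
    freeCoeff ε L (fun a => PowerSeries.map φ (w a)) = φ ∘ freeCoeff ε L w := by
  ext (p | p) <;> simp [freeCoeff]

end triangular

/-! ### Second-order Taylor expansion of polynomials. -/

section taylor

/-- The displacements are variables, so the remainder is a polynomial over S that can later be
evaluated in every S-algebra. No division by factorials occurs, so the characteristic plays no role.
-/
lemma exists_taylor {k S σ : Type*} [CommRing k] [CommRing S] [Fintype σ] (g : k →+* S)
    (a : σ → S) (s : S) (f : MvPolynomial σ k) :
    ∃ q : MvPolynomial σ S,
      MvPolynomial.eval₂ (MvPolynomial.C.comp g)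
        (fun i => MvPolynomial.C (a i) + MvPolynomial.C s * MvPolynomial.X i) f =
      MvPolynomial.C (MvPolynomial.eval₂ g a f) + MvPolynomial.C s *
        ∑ i, MvPolynomial.C (MvPolynomial.eval₂ g a (MvPolynomial.pderiv i f)) * MvPolynomial.X i +
      MvPolynomial.C (s ^ 2) * q := by
  classical
  induction f using MvPolynomial.induction_on with
  | C r => exact ⟨0, by simp⟩
  | add f₁ f₂ h₁ h₂ =>
    obtain ⟨q₁, h₁⟩ := h₁
    obtain ⟨q₂, h₂⟩ := h₂
    refine ⟨q₁ + q₂, ?_⟩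
    simp only [MvPolynomial.eval₂_add, h₁, h₂, map_add, add_mul, Finset.sum_add_distrib]
    ring
  | mul_X f j h =>
    obtain ⟨q, h⟩ := h
    let d : MvPolynomial σ S :=
      ∑ i, MvPolynomial.C (MvPolynomial.eval₂ g a (MvPolynomial.pderiv i f)) * MvPolynomial.X i
    have hd : ∑ i, MvPolynomial.C (MvPolynomial.eval₂ g a (MvPolynomial.pderiv i
        (f * MvPolynomial.X j))) * MvPolynomial.X i =
        MvPolynomial.C (a j) * d +
          MvPolynomial.C (MvPolynomial.eval₂ g a f) * (MvPolynomial.X j : MvPolynomial σ S) := by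
      simp only [MvPolynomial.pderiv_mul, MvPolynomial.pderiv_X, MvPolynomial.eval₂_add,
        MvPolynomial.eval₂_mul, MvPolynomial.eval₂_X, map_add, map_mul, add_mul,
        Finset.sum_add_distrib, d, Finset.mul_sum]
      congr 1
      · refine Finset.sum_congr rfl fun i _ => by ring
      · rw [Finset.sum_eq_single j]
        · simp
        · intro b _ hb
          simp [hb.symm]
        · simp
    -- The coefficient of s² in (f(a) + s d + s² q)(a_j + s X_j), with the higher terms kept in the
    -- second summand.
    refine ⟨d * MvPolynomial.X j + (MvPolynomial.C (a j) + MvPolynomial.C s * MvPolynomial.X j) * q,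
      ?_⟩
    rw [MvPolynomial.eval₂_mul, MvPolynomial.eval₂_X, h, hd, MvPolynomial.eval₂_mul,
      MvPolynomial.eval₂_X]
    change (_ + _ * d + _) * _ = _
    simp only [map_mul, map_pow]
    ring

end taylor

/-! ### Truncation of power series and reduction of truncated polynomials. -/

section truncation

variable {R R' : Type u} [CommRing R] [CommRing R']

/-- The reduction homomorphism `R[t]/(t^(m+1)) → R[t]/(t^(n+1))`. -/
def TruncPoly.reduce (R : Type u) [CommRing R] {n m : ℕ} (h : n ≤ m) :
    TruncPoly m R →+* TruncPoly n R :=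
  Ideal.Quotient.factor (Ideal.span_singleton_le_span_singleton.2
    (pow_dvd_pow (X : R[X]) (Nat.succ_le_succ h)))

lemma truncHom_eq_iff (m : ℕ) (f g : PowerSeries R) :
    truncHom m R f = truncHom m R g ↔ PowerSeries.X ^ (m + 1) ∣ f - g := by
  change Ideal.Quotient.mk _ (PowerSeries.trunc (m + 1) f) =
    Ideal.Quotient.mk _ (PowerSeries.trunc (m + 1) g) ↔ _
  rw [Ideal.Quotient.eq, Ideal.mem_span_singleton, Polynomial.X_pow_dvd_iff,
    PowerSeries.X_pow_dvd_iff]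
  refine forall_congr' fun i => forall_congr' fun hi => ?_
  rw [← map_sub, PowerSeries.coeff_trunc, if_pos hi]

lemma truncHom_surjective (m : ℕ) : Function.Surjective (truncHom m R) := by
  intro y
  obtain ⟨p, rfl⟩ := Ideal.Quotient.mk_surjective y
  refine ⟨(p : PowerSeries R), ?_⟩
  change Ideal.Quotient.mk _ (PowerSeries.trunc (m + 1) (p : PowerSeries R)) = _
  rw [Ideal.Quotient.eq, Ideal.mem_span_singleton, Polynomial.X_pow_dvd_iff]
  intro i hi
  rw [Polynomial.coeff_sub, PowerSeries.coeff_trunc, if_pos hi, Polynomial.coeff_coe, sub_self]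

lemma reduce_truncHom {n m : ℕ} (h : n ≤ m) (f : PowerSeries R) :
    TruncPoly.reduce R h (truncHom m R f) = truncHom n R f := by
  change Ideal.Quotient.mk _ (PowerSeries.trunc (m + 1) f) =
    Ideal.Quotient.mk _ (PowerSeries.trunc (n + 1) f)
  rw [Ideal.Quotient.eq, Ideal.mem_span_singleton, Polynomial.X_pow_dvd_iff]
  intro i hi
  rw [Polynomial.coeff_sub, PowerSeries.coeff_trunc, if_pos (by omega), PowerSeries.coeff_trunc,
    if_pos hi, sub_self]

lemma map_truncHom (m : ℕ) (φ : R →+* R') (f : PowerSeries R) :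
    TruncPoly.map m φ (truncHom m R f) = truncHom m R' (PowerSeries.map φ f) := by
  change Ideal.Quotient.mk _ (Polynomial.map φ (PowerSeries.trunc (m + 1) f)) =
    Ideal.Quotient.mk _ (PowerSeries.trunc (m + 1) _)
  congr 1
  ext i
  rw [Polynomial.coeff_map, PowerSeries.coeff_trunc, PowerSeries.coeff_trunc, PowerSeries.coeff_map]
  split_ifs <;> simp

lemma truncHom_C (m : ℕ) (r : R) :
    truncHom m R (PowerSeries.C r) = algebraMap R (TruncPoly m R) r := by
  change Ideal.Quotient.mk _ (PowerSeries.trunc (m + 1) (PowerSeries.C r)) =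
    Ideal.Quotient.mk _ (Polynomial.C r)
  rw [PowerSeries.trunc_C]

end truncation

/-! ### Jets in coordinates and the universal lift. -/

section jets

variable {k R R' : Type u} [CommRing k] [CommRing R] [CommRing R'] {σ : Type*} {c n m : ℕ}

/-- The coordinates of an `R`-valued `m`-jet on `h = 0` which extends the `n`-jet of `γ`. -/
def IsJetLift (h : Fin c → MvPolynomial σ k) (γ : σ → PowerSeries k) (hnm : n ≤ m) (ρ : k →+* R)
    (x : σ → TruncPoly m R) : Prop :=
  (∀ i, TruncPoly.reduce R hnm (x i) = truncHom n R (PowerSeries.map ρ (γ i))) ∧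
    ∀ l, MvPolynomial.eval₂ ((algebraMap R (TruncPoly m R)).comp ρ) x (h l) = 0

/-- The lifts of the `n`-jet of `γ` in coordinates which are adapted to the Jacobian matrix. -/
def liftOfCoords {τ : Type*} [Fintype τ] (γ : σ → PowerSeries k) (n m : ℕ)
    (P : Matrix σ τ (PowerSeries k)) (ρ : k →+* R) (w : τ → PowerSeries R) (i : σ) :
    TruncPoly m R :=
  truncHom m R (PowerSeries.map ρ (γ i) +
    PowerSeries.X ^ (n + 1) * ((P.map (PowerSeries.map ρ)).mulVec w) i)

lemma map_liftOfCoords {τ : Type*} [Fintype τ] (γ : σ → PowerSeries k)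
    (P : Matrix σ τ (PowerSeries k)) (ρ : k →+* R) (φ : R →+* R') (w : τ → PowerSeries R) (i : σ) :
    TruncPoly.map m φ (liftOfCoords γ n m P ρ w i) =
      liftOfCoords γ n m P (φ.comp ρ) (fun a => PowerSeries.map φ (w a)) i := by
  rw [liftOfCoords, map_truncHom, liftOfCoords]
  congr 1
  have hc (f : PowerSeries k) :
      PowerSeries.map φ (PowerSeries.map ρ f) = PowerSeries.map (φ.comp ρ) f := by
    ext; simp
  rw [map_add, map_mul, map_pow, PowerSeries.map_X, hc]
  · congr 2
    simp only [Matrix.mulVec, dotProduct, map_sum, map_mul, Matrix.map_apply]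
    exact Finset.sum_congr rfl fun a _ => by rw [hc]

lemma dvd_mulVec {α β : Type*} [Fintype β] {f : R} (B : Matrix α β R) (v : β → R)
    (hv : ∀ b, f ∣ v b) (a : α) : f ∣ (B.mulVec v) a :=
  Finset.dvd_sum fun b _ => (hv b).mul_left _

/-- A lift x has the form γ + X^{n+1} z, and modulo X^{m+1} = X^{n+1+L} only z modulo X^L matters.
As P is invertible, w ≡ P' z modulo X^L, and truncation at L selects one representative. -/
lemma existsUnique_liftOfCoords [Fintype σ] [DecidableEq σ] {τ : Type*} [Fintype τ] [DecidableEq τ]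
    {L : ℕ} (hm : m = n + L) (γ : σ → PowerSeries k) (P : Matrix σ τ (PowerSeries k))
    (P' : Matrix τ σ (PowerSeries k)) (hPP' : P * P' = 1) (hP'P : P' * P = 1) (ρ : k →+* R)
    (x : σ → TruncPoly m R)
    (hx : ∀ i, TruncPoly.reduce R (by omega : n ≤ m) (x i) =
      truncHom n R (PowerSeries.map ρ (γ i))) :
    ∃! w : τ → PowerSeries R, IsTruncated L w ∧ liftOfCoords γ n m P ρ w = x := by
  let A : Matrix σ τ (PowerSeries R) := P.map (PowerSeries.map ρ)
  let A' : Matrix τ σ (PowerSeries R) := P'.map (PowerSeries.map ρ)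
  have hA : A * A' = 1 := by
    rw [← Matrix.map_mul, hPP', Matrix.map_one _ (map_zero _) (map_one _)]
  have hA' : A' * A = 1 := by
    rw [← Matrix.map_mul, hP'P, Matrix.map_one _ (map_zero _) (map_one _)]
  have hm' : m + 1 = n + 1 + L := by omega
  choose y hy using fun i => truncHom_surjective m (x i)
  have hz (i) : PowerSeries.X ^ (n + 1) ∣ y i - PowerSeries.map ρ (γ i) := by
    rw [← truncHom_eq_iff, ← hx, ← hy, reduce_truncHom]
  choose z hz using hz
  have hlift (w : τ → PowerSeries R) : liftOfCoords γ n m P ρ w = x ↔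
      ∀ i, PowerSeries.X ^ L ∣ (A.mulVec w - z) i := by
    rw [funext_iff]
    refine forall_congr' fun i => ?_
    have : PowerSeries.map ρ (γ i) + PowerSeries.X ^ (n + 1) * (A.mulVec w) i - y i =
        PowerSeries.X ^ (n + 1) * (A.mulVec w - z) i := by
      rw [Pi.sub_apply, mul_sub, ← hz]
      ring
    rw [← hy, liftOfCoords, truncHom_eq_iff, this, hm', X_pow_mul_dvd_X_pow_mul]
  have hlift' (w : τ → PowerSeries R) : liftOfCoords γ n m P ρ w = x ↔
      AgreeUpTo L w (A'.mulVec z) := by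
    rw [hlift, agreeUpTo_iff]
    constructor
    · intro h a
      have := dvd_mulVec A' _ h a
      rw [Matrix.mulVec_sub, Matrix.mulVec_mulVec, hA', Matrix.one_mulVec] at this
      exact this
    · intro h i
      have := dvd_mulVec A _ h i
      change _ ∣ (A.mulVec (w - A'.mulVec z)) i at this
      rw [Matrix.mulVec_sub, Matrix.mulVec_mulVec, hA, Matrix.one_mulVec] at this
      exact this
  simp only [hlift']
  refine ⟨fun a => (PowerSeries.trunc L (A'.mulVec z a) : R[X]), ⟨fun a l hl => ?_,
    fun a l hl => ?_⟩, fun w hw => ?_⟩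
  · rw [Polynomial.coeff_coe, PowerSeries.coeff_trunc, if_neg (by omega)]
  · rw [Polynomial.coeff_coe, PowerSeries.coeff_trunc, if_pos hl]
  · ext a l
    rw [Polynomial.coeff_coe, PowerSeries.coeff_trunc]
    split_ifs with hl
    · exact hw.2 a l hl
    · exact hw.1 a l (by omega)

/-- In adapted coordinates the equations of the lifts become triangular. -/
lemma exists_isJetLift_iff [Fintype σ] [DecidableEq σ] {κ : Type} [Fintype κ] [DecidableEq κ]
    {L : ℕ} (hm : m = n + L) (h : Fin c → MvPolynomial σ k) (γ : σ → PowerSeries k)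
    (hγ : ∀ l, MvPolynomial.eval₂ PowerSeries.C γ (h l) = 0)
    (P : Matrix σ (Fin c ⊕ κ) (PowerSeries k)) (U U' : Matrix (Fin c) (Fin c) (PowerSeries k))
    (hU : U' * U = 1) (ε : Fin c → ℕ)
    (hJ : U * (Matrix.of fun l i => MvPolynomial.eval₂ PowerSeries.C γ (MvPolynomial.pderiv i (h l)))
      * P = Matrix.fromCols (Matrix.diagonal fun i => PowerSeries.X ^ ε i) 0) :
    ∃ q : Fin c → MvPolynomial (Fin c ⊕ κ) (PowerSeries k), ∀ {R : Type u} [CommRing R]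
      (ρ : k →+* R) (w : Fin c ⊕ κ → PowerSeries R),
      IsJetLift h γ (by omega : n ≤ m) ρ (liftOfCoords γ n m P ρ w) ↔
        IsTriangularSolution ε L n q ρ w := by
  -- The remainders live over k⟦X⟧ and are chosen before R, so the same system serves all R.
  choose q hq using fun l => exists_taylor PowerSeries.C γ (PowerSeries.X ^ (n + 1)) (h l)
  let J : Matrix (Fin c) σ (PowerSeries k) :=
    Matrix.of fun l i => MvPolynomial.eval₂ PowerSeries.C γ (MvPolynomial.pderiv i (h l))
  let q' (l) : MvPolynomial (Fin c ⊕ κ) (PowerSeries k) :=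
    MvPolynomial.eval₂ MvPolynomial.C (fun i => ∑ a, MvPolynomial.C (P i a) * MvPolynomial.X a) (q l)
  refine ⟨fun i => ∑ l, MvPolynomial.C (U i l) * q' l, fun {R} _ ρ w => ?_⟩
  let z : σ → PowerSeries R := (P.map (PowerSeries.map ρ)).mulVec w
  let y : σ → PowerSeries R := fun i => PowerSeries.map ρ (γ i) + PowerSeries.X ^ (n + 1) * z i
  let F (l) : PowerSeries R := MvPolynomial.eval₂ (PowerSeries.C.comp ρ) y (h l)
  have hz : IsJetLift h γ (by omega : n ≤ m) ρ (liftOfCoords γ n m P ρ w) ↔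
      ∀ l, PowerSeries.X ^ (m + 1) ∣ F l := by
    rw [IsJetLift, and_iff_right]
    · refine forall_congr' fun l => ?_
      have h1 : MvPolynomial.eval₂ ((algebraMap R (TruncPoly m R)).comp ρ)
          (liftOfCoords γ n m P ρ w) (h l) = truncHom m R (F l) := by
        rw [MvPolynomial.eval₂_comp_left]
        congr 1
        ext r
        exact (truncHom_C m (ρ r)).symm
      rw [h1, ← map_zero (truncHom m R), truncHom_eq_iff, sub_zero]
    · intro i
      rw [liftOfCoords, reduce_truncHom, truncHom_eq_iff, add_sub_cancel_left]
      exact dvd_mul_right _ _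
  have hF (l) : F l = PowerSeries.X ^ (n + 1) *
      (((J.map (PowerSeries.map ρ)).mulVec z) l + PowerSeries.X ^ (n + 1) *
        evalSeries ρ z (q l)) := by
    have h1 := congrArg (evalSeries ρ z) (hq l)
    have h2 : evalSeries ρ z (MvPolynomial.eval₂ (MvPolynomial.C.comp PowerSeries.C)
        (fun i => MvPolynomial.C (γ i) + MvPolynomial.C (PowerSeries.X ^ (n + 1)) *
          MvPolynomial.X i) (h l)) = F l := by
      rw [MvPolynomial.eval₂_comp_left]
      congr 1
      · ext r : 1
        simp
      · ext1 i
        simp [y]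
    rw [← h2, h1, hγ]
    simp only [map_add, map_mul, map_sum, map_zero, zero_add, map_pow, mul_add,
      MvPolynomial.coe_eval₂Hom, MvPolynomial.eval₂_C, MvPolynomial.eval₂_X, PowerSeries.map_X]
    congr 1
    ring
  -- With z = P w, multiplication by U brings the linear part U J P w to normal form; only the
  -- coordinates `Sum.inl` survive in it.
  have hUF (i) : ((U.map (PowerSeries.map ρ)).mulVec F) i = PowerSeries.X ^ (n + 1) *
      (PowerSeries.X ^ ε i * w (Sum.inl i) + PowerSeries.X ^ (n + 1) *
        evalSeries ρ w (∑ l, MvPolynomial.C (U i l) * q' l)) := by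
    have h1 (l) : evalSeries ρ w (q' l) = evalSeries ρ z (q l) := by
      rw [MvPolynomial.eval₂_comp_left, MvPolynomial.coe_eval₂Hom]
      congr 1
      · ext1 r
        simp
      · ext1 i
        simp [z, Matrix.mulVec, dotProduct]
    have h2 : (U.map (PowerSeries.map ρ)).mulVec ((J.map (PowerSeries.map ρ)).mulVec z) =
        fun i => PowerSeries.X ^ ε i * w (Sum.inl i) := by
      rw [Matrix.mulVec_mulVec, Matrix.mulVec_mulVec, ← Matrix.map_mul, ← Matrix.map_mul, hJ]
      ext1 i
      simp [Matrix.mulVec, dotProduct, Matrix.diagonal_apply, apply_ite (PowerSeries.map ρ)]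
    have h3 := congrFun h2 i
    rw [← h3]
    simp only [Matrix.mulVec, dotProduct, Matrix.map_apply, hF, mul_add, map_sum, map_mul,
      Finset.mul_sum, Finset.sum_add_distrib, h1]
    congr 1
    · refine Finset.sum_congr rfl fun l _ => Finset.sum_congr rfl fun _ _ => by ring
    · refine Finset.sum_congr rfl fun l _ => ?_
      have h4 : evalSeries ρ w (MvPolynomial.C (U i l)) = PowerSeries.map ρ (U i l) :=
        MvPolynomial.eval₂_C _ _ _
      rw [h4]
      ring
  have hm' : m + 1 = n + 1 + L := by omega
  -- The left inverse U' recovers F from U F, so no equation is lost.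
  have hUF' : (∀ l, PowerSeries.X ^ (m + 1) ∣ F l) ↔
      ∀ i, PowerSeries.X ^ (m + 1) ∣ ((U.map (PowerSeries.map ρ)).mulVec F) i := by
    refine ⟨fun h => dvd_mulVec _ _ h, fun h => ?_⟩
    have := dvd_mulVec (U'.map (PowerSeries.map ρ)) _ h
    rwa [Matrix.mulVec_mulVec, ← Matrix.map_mul, hU, Matrix.map_one _ (map_zero _) (map_one _),
      Matrix.one_mulVec] at this
  rw [hz, hUF']
  refine forall_congr' fun i => ?_
  rw [hUF, hm', X_pow_mul_dvd_X_pow_mul]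

/-- There is a universal lift of the `n`-jet of `γ` to an `m`-jet, over a polynomial ring. -/
lemma exists_universal_isJetLift {k : Type u} [Field k] [Fintype σ] [DecidableEq σ] {d e : ℕ}
    (hσ : Fintype.card σ = c + d) (h : Fin c → MvPolynomial σ k) (γ : σ → PowerSeries k)
    (hγ : ∀ l, MvPolynomial.eval₂ PowerSeries.C γ (h l) = 0) (s : Fin c → σ)
    (hs : (Matrix.of fun l j => MvPolynomial.eval₂ PowerSeries.C γ
      (MvPolynomial.pderiv (s j) (h l))).det.order = e)
    (hs' : ∀ s : Fin c → σ, (e : ℕ∞) ≤ (Matrix.of fun l j => MvPolynomial.eval₂ PowerSeries.C γ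
      (MvPolynomial.pderiv (s j) (h l))).det.order)
    (hm : n + e ≤ m) (hn : e ≤ n) :
    ∃ x : σ → TruncPoly m (MvPolynomial (Fin ((m - n) * d + e)) k),
      IsJetLift h γ (by omega : n ≤ m) MvPolynomial.C x ∧
      ∀ {R : Type u} [CommRing R] (ρ : k →+* R) (y : σ → TruncPoly m R),
        IsJetLift h γ (by omega : n ≤ m) ρ y →
        ∃! φ : MvPolynomial (Fin ((m - n) * d + e)) k →+* R,
          φ.comp MvPolynomial.C = ρ ∧ ∀ i, TruncPoly.map m φ (x i) = y i := by
  let J : Matrix (Fin c) σ (PowerSeries k) :=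
    Matrix.of fun l i => MvPolynomial.eval₂ PowerSeries.C γ (MvPolynomial.pderiv i (h l))
  obtain ⟨κ, _, _, P, P', U, U', ε, hκ, hPP', hP'P, hU, hε, hJ⟩ := exists_normalForm J s hs hs'
  obtain ⟨L, rfl⟩ : ∃ L, m = n + L := ⟨m - n, by omega⟩
  have hεe (i) : ε i ≤ e := hε ▸ Finset.single_le_sum (fun _ _ => Nat.zero_le _) (Finset.mem_univ i)
  have hεL (i) : ε i ≤ L := (hεe i).trans (by omega)
  have hεn (i) : ε i ≤ n := (hεe i).trans hn
  obtain ⟨q, hq⟩ := exists_isJetLift_iff (L := L) rfl h γ hγ P U U' hU ε hJ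
  -- There are L coefficients for each of the d cleared columns and ε_i for each equation, with Σ
  -- ε_i = e.
  let E : FreeIndex κ ε L ≃ Fin ((n + L - n) * d + e) := Fintype.equivFinOfCardEq (by
    rw [card_freeIndex, hε, Nat.add_sub_cancel_left]
    have : Fintype.card κ = d := by omega
    rw [this])
  -- The universal solution: its free coefficients are the variables of the polynomial ring.
  obtain ⟨w, ⟨hw, hwq, hwE⟩, -⟩ := existsUnique_isTriangularSolution (q := q) hεL hεn
    (MvPolynomial.C : k →+* MvPolynomial (Fin ((n + L - n) * d + e)) k)
    (fun a => MvPolynomial.X (E a))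
  refine ⟨liftOfCoords γ n (n + L) P MvPolynomial.C w, (hq _ _).2 hwq, fun {R} _ ρ y hy => ?_⟩
  obtain ⟨v, ⟨hv, hvy⟩, hv'⟩ := existsUnique_liftOfCoords (L := L) rfl γ P P' hPP' hP'P ρ y hy.1
  have hvq : IsTriangularSolution ε L n q ρ v := by rwa [← hq, hvy]
  -- Sending the variables to the free coefficients of v makes the specialised universal solution
  -- and v two solutions with equal free coefficients, hence equal. Conversely any admissible φ must
  -- carry w to v, which fixes its values on the variables.
  refine ⟨MvPolynomial.eval₂Hom ρ (fun j => freeCoeff ε L v (E.symm j)), ⟨?_, fun i => ?_⟩, ?_⟩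
  · exact MvPolynomial.eval₂Hom_comp_C _ _
  · rw [map_liftOfCoords, MvPolynomial.eval₂Hom_comp_C, ← hvy]
    congr 1
    refine (existsUnique_isTriangularSolution (q := q) hεL hεn ρ (freeCoeff ε L v)).unique
      ⟨hw.map _, ?_, ?_⟩ ⟨hv, hvq, rfl⟩
    · have := hwq.map (MvPolynomial.eval₂Hom ρ (fun j => freeCoeff ε L v (E.symm j)))
      rwa [MvPolynomial.eval₂Hom_comp_C] at this
    · rw [freeCoeff_map, hwE]
      ext1 a
      simp
  · rintro φ ⟨rfl, hφ⟩
    have h1 : (fun a => PowerSeries.map φ (w a)) = v := by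
      refine hv' _ ⟨hw.map _, ?_⟩
      ext1 i
      rw [← hφ, map_liftOfCoords]
    refine MvPolynomial.ringHom_ext (fun r => by simp) fun j => ?_
    rw [MvPolynomial.coe_eval₂Hom, MvPolynomial.eval₂_X, ← h1, freeCoeff_map, hwE]
    simp

end jets

/-! ### Affine points of jet schemes and of the fibre as morphisms from discs. -/

section fibre

variable {k : Type u} [CommRing k] {n m : ℕ} {R R' : Type u} [CommRing R] [CommRing R']

/-- `Spec R` as a `k`-scheme. -/
abbrev specOver (ρ : k →+* R) : Over (Spec (.of k)) :=
  Over.mk (Spec.map (CommRingCat.ofHom ρ) : Spec (.of R) ⟶ Spec (.of k))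

/-- A ring homomorphism under `k` as a morphism of affine `k`-schemes. -/
def specOverMap {ρ : k →+* R} {ρ' : k →+* R'} (φ : R →+* R') (h : φ.comp ρ = ρ') :
    specOver ρ' ⟶ specOver ρ :=
  Over.homMk (Spec.map (CommRingCat.ofHom φ) : Spec (.of R') ⟶ Spec (.of R)) (by
    subst h
    exact (Spec.map_comp _ _).symm)

lemma isPullback_spec_truncPoly (n : ℕ) (ρ : k →+* R) :
    IsPullback (Spec.map (CommRingCat.ofHom (algebraMap R (TruncPoly n R))))
      (Spec.map (CommRingCat.ofHom (TruncPoly.map n ρ)))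
      (Spec.map (CommRingCat.ofHom ρ)) (jetDisc k n) :=
  isPullback_SpecMap_of_isPushout _ _ _ _ (TruncPoly.isPushout n (CommRingCat.ofHom ρ))

/-- `Spec R[t]/(t^(n+1))` is the thickening of `Spec R`. -/
def specTruncIso (n : ℕ) (ρ : k →+* R) :
    Spec (.of (TruncPoly n R)) ≅ ((jetThickening k n).obj (specOver ρ)).left :=
  (isPullback_spec_truncPoly n ρ).isoPullback

lemma specTruncIso_hom_fst (n : ℕ) (ρ : k →+* R) :
    (specTruncIso n ρ).hom ≫ pullback.fst (specOver ρ).hom (jetDisc k n) =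
      Spec.map (CommRingCat.ofHom (algebraMap R (TruncPoly n R))) :=
  (isPullback_spec_truncPoly n ρ).isoPullback_hom_fst

lemma specTruncIso_hom_snd (n : ℕ) (ρ : k →+* R) :
    (specTruncIso n ρ).hom ≫ pullback.snd (specOver ρ).hom (jetDisc k n) =
      Spec.map (CommRingCat.ofHom (TruncPoly.map n ρ)) :=
  (isPullback_spec_truncPoly n ρ).isoPullback_hom_snd

lemma specTruncIso_hom_comp_hom (n : ℕ) (ρ : k →+* R) :
    (specTruncIso n ρ).hom ≫ ((jetThickening k n).obj (specOver ρ)).hom =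
      Spec.map (CommRingCat.ofHom ((algebraMap R (TruncPoly n R)).comp ρ)) := by
  refine (Category.assoc _ _ _).symm.trans ?_
  refine (congrArg (· ≫ (specOver ρ).hom) (specTruncIso_hom_fst n ρ)).trans ?_
  exact (Spec.map_comp _ _).symm

lemma specTruncIso_naturality {ρ : k →+* R} {ρ' : k →+* R'} (φ : R →+* R') (h : φ.comp ρ = ρ') :
    (specTruncIso n ρ').hom ≫ ((jetThickening k n).map (specOverMap φ h)).left =
      Spec.map (CommRingCat.ofHom (TruncPoly.map n φ)) ≫ (specTruncIso n ρ).hom := by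
  apply pullback.hom_ext
  · refine (Category.assoc _ _ _).trans ?_
    refine (congrArg (_ ≫ ·) (pullback.lift_fst _ _ _)).trans ?_
    refine Eq.trans ?_ (Category.assoc _ _ _).symm
    refine Eq.trans ?_ (congrArg (_ ≫ ·) (specTruncIso_hom_fst n ρ).symm)
    refine (Category.assoc _ _ _).symm.trans ?_
    refine (congrArg (· ≫ _) (specTruncIso_hom_fst n ρ')).trans ?_
    refine (Spec.map_comp _ _).symm.trans (Eq.trans ?_ (Spec.map_comp _ _))
    congr 1
    ext x
    change algebraMap R' _ (φ x) = TruncPoly.map n φ (Ideal.Quotient.mk _ (C x))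
    rw [TruncPoly.map, Ideal.quotientMap_mk]
    simp only [coe_mapRingHom, map_C]
    rfl
  · refine (Category.assoc _ _ _).trans ?_
    refine (congrArg (_ ≫ ·) (pullback.lift_snd _ _ _)).trans ?_
    refine Eq.trans ?_ (Category.assoc _ _ _).symm
    refine Eq.trans ?_ (congrArg (_ ≫ ·) (specTruncIso_hom_snd n ρ).symm)
    refine (specTruncIso_hom_snd n ρ').trans ?_
    refine Eq.trans ?_ (Spec.map_comp _ _)
    refine congrArg Spec.map (CommRingCat.hom_ext (RingHom.ext fun x => ?_))
    obtain ⟨x, rfl⟩ := Ideal.Quotient.mk_surjective x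
    subst h
    simp [TruncPoly.map, Ideal.quotientMap_mk, Polynomial.map_map]

lemma specTruncIso_thickeningMap (ρ : k →+* R) (h : n ≤ m) :
    (specTruncIso n ρ).hom ≫ ((jetThickeningMap k h).app (specOver ρ)).left =
      Spec.map (CommRingCat.ofHom (TruncPoly.reduce R h)) ≫ (specTruncIso m ρ).hom := by
  apply pullback.hom_ext
  · refine (Category.assoc _ _ _).trans ?_
    refine (congrArg (_ ≫ ·) (pullback.lift_fst _ _ _)).trans ?_
    refine Eq.trans ?_ (Category.assoc _ _ _).symm
    refine Eq.trans ?_ (congrArg (_ ≫ ·) (specTruncIso_hom_fst m ρ).symm)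
    exact (specTruncIso_hom_fst n ρ).trans (Eq.trans rfl (Spec.map_comp
      (CommRingCat.ofHom (algebraMap R (TruncPoly m R))) (CommRingCat.ofHom (TruncPoly.reduce R h))))
  · refine (Category.assoc _ _ _).trans ?_
    refine (congrArg (_ ≫ ·) (pullback.lift_snd _ _ _)).trans ?_
    refine Eq.trans ?_ (Category.assoc _ _ _).symm
    refine Eq.trans ?_ (congrArg (_ ≫ ·) (specTruncIso_hom_snd m ρ).symm)
    refine (Category.assoc _ _ _).symm.trans ?_
    refine (congrArg (· ≫ _) (specTruncIso_hom_snd n ρ)).trans ?_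
    refine (Spec.map_comp _ _).symm.trans (Eq.trans ?_ (Spec.map_comp _ _))
    refine congrArg Spec.map (CommRingCat.hom_ext (RingHom.ext fun x => ?_))
    obtain ⟨x, rfl⟩ := Ideal.Quotient.mk_surjective x
    rfl

variable {Y : Over (Spec (.of k))}

/-- A morphism from `Spec R[t]/(t^(m+1))` over `k` lifting the `n`-jet of `γ`. -/
structure IsDiscLift (γ : Arc Y) (hnm : n ≤ m) (ρ : k →+* R)
    (g : Spec (.of (TruncPoly m R)) ⟶ Y.left) : Prop where
  comp_hom : g ≫ Y.hom = Spec.map (CommRingCat.ofHom ((algebraMap R (TruncPoly m R)).comp ρ))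
  reduce_comp : Spec.map (CommRingCat.ofHom (TruncPoly.reduce R hnm)) ≫ g =
    (Spec.map (CommRingCat.ofHom (TruncPoly.map n ρ)) ≫ discToFormalDisc n k) ≫ γ.left

/-- The family of discs corresponding to an `R`-point of the jet scheme. -/
def jetDiscOf {ρ : k →+* R} (a : specOver ρ ⟶ (jetScheme k m).obj Y) :
    Spec (.of (TruncPoly m R)) ⟶ Y.left :=
  (specTruncIso m ρ).hom ≫ (((jetAdjunction k m).homEquiv _ _).symm a).left

lemma jetDiscOf_injective {ρ : k →+* R} :
    Function.Injective (jetDiscOf (Y := Y) (m := m) (ρ := ρ)) := by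
  intro a b hab
  have := (cancel_epi (specTruncIso m ρ).hom).1 hab
  exact ((jetAdjunction k m).homEquiv _ _).symm.injective (Over.OverMorphism.ext this)

lemma jetDiscOf_surjective {ρ : k →+* R} (g : Spec (.of (TruncPoly m R)) ⟶ Y.left)
    (hg : g ≫ Y.hom = Spec.map (CommRingCat.ofHom ((algebraMap R (TruncPoly m R)).comp ρ))) :
    ∃ a : specOver ρ ⟶ (jetScheme k m).obj Y, jetDiscOf a = g := by
  let b : (jetThickening k m).obj (specOver ρ) ⟶ Y := Over.homMk ((specTruncIso m ρ).inv ≫ g) (by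
    rw [Category.assoc, hg, Iso.inv_comp_eq]
    exact (specTruncIso_hom_comp_hom m ρ).symm)
  refine ⟨(jetAdjunction k m).homEquiv _ _ b, ?_⟩
  rw [jetDiscOf, Equiv.symm_apply_apply]
  exact Iso.hom_inv_id_assoc _ _

lemma jetDiscOf_comp_hom {ρ : k →+* R} (a : specOver ρ ⟶ (jetScheme k m).obj Y) :
    jetDiscOf a ≫ Y.hom =
      Spec.map (CommRingCat.ofHom ((algebraMap R (TruncPoly m R)).comp ρ)) := by
  rw [jetDiscOf, Category.assoc, Over.w]
  exact specTruncIso_hom_comp_hom m ρ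

lemma jetDiscOf_naturality {ρ : k →+* R} {ρ' : k →+* R'} (φ : R →+* R') (h : φ.comp ρ = ρ')
    (a : specOver ρ ⟶ (jetScheme k m).obj Y) :
    jetDiscOf (specOverMap φ h ≫ a) =
      Spec.map (CommRingCat.ofHom (TruncPoly.map m φ)) ≫ jetDiscOf a := by
  rw [jetDiscOf, Adjunction.homEquiv_naturality_left_symm, Over.comp_left, ← Category.assoc,
    specTruncIso_naturality, Category.assoc]
  rfl

/-- The truncation is the conjugate of the inclusion of thickenings, so its compatibility with the
counits turns composition with it into restriction of discs. -/
lemma jetDiscOf_truncation {ρ : k →+* R} (h : n ≤ m) (a : specOver ρ ⟶ (jetScheme k m).obj Y) :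
    jetDiscOf (a ≫ (jetTruncation k h).app Y) =
      Spec.map (CommRingCat.ofHom (TruncPoly.reduce R h)) ≫ jetDiscOf a := by
  have key : ((jetAdjunction k n).homEquiv _ _).symm (a ≫ (jetTruncation k h).app Y) =
      (jetThickeningMap k h).app _ ≫ ((jetAdjunction k m).homEquiv _ _).symm a := by
    rw [Adjunction.homEquiv_naturality_left_symm]
    simp only [Adjunction.homEquiv_symm_apply]
    rw [← NatTrans.naturality_assoc]
    exact congrArg (_ ≫ ·) (conjugateEquiv_counit _ _ (jetThickeningMap k h) Y)
  rw [jetDiscOf, key, Over.comp_left, ← Category.assoc, specTruncIso_thickeningMap, Category.assoc]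
  rfl

/-- The structure morphism of `Spec R` as a morphism of `k`-schemes. -/
def specOverHom (ρ : k →+* R) : specOver ρ ⟶ Over.mk (𝟙 (Spec (.of k))) :=
  Over.homMk (specOver ρ).hom (Category.comp_id _)

/-- By naturality of the adjunction, pulling the k-point back along Spec R → Spec k base changes its
disc. -/
lemma jetDiscOf_jet (ρ : k →+* R) (γ : Arc Y) :
    jetDiscOf (specOverHom ρ ≫ γ.jet n) =
      (Spec.map (CommRingCat.ofHom (TruncPoly.map n ρ)) ≫ discToFormalDisc n k) ≫ γ.left := by
  rw [jetDiscOf, Adjunction.homEquiv_naturality_left_symm, Arc.jet, Equiv.symm_apply_apply,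
    Over.comp_left]
  let q : ((jetThickening k n).obj (Over.mk (𝟙 (Spec (.of k))))).left ⟶
    Spec (.of (TruncPoly n k)) := pullback.snd _ _
  have h1 : ((jetThickening k n).map (specOverHom ρ)).left ≫ q =
      pullback.snd (specOver ρ).hom (jetDisc k n) := pullback.lift_snd _ _ _
  have h2 : (specTruncIso n ρ).hom ≫ ((jetThickening k n).map (specOverHom ρ)).left ≫ q =
      Spec.map (CommRingCat.ofHom (TruncPoly.map n ρ)) :=
    (congrArg (_ ≫ ·) h1).trans (specTruncIso_hom_snd n ρ)
  rw [← h2]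
  change (specTruncIso n ρ).hom ≫ ((jetThickening k n).map (specOverHom ρ)).left ≫ q ≫
    discToFormalDisc n k ≫ γ.left = _
  have h3 {A B C D E F : Scheme.{u}} (a : A ⟶ B) (b : B ⟶ C) (c : C ⟶ D) (d : D ⟶ E)
      (f : E ⟶ F) : a ≫ b ≫ c ≫ d ≫ f = ((a ≫ b ≫ c) ≫ d) ≫ f := by
    simp only [Category.assoc]
  exact h3 _ _ q (discToFormalDisc n k) γ.left

/-- The projection of the fibre to the jet scheme. -/
def jetFibreι (γ : Arc Y) (hnm : n ≤ m) : γ.jetFibre n hnm ⟶ (jetScheme k m).obj Y :=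
  pullback.fst _ _

/-- The structure morphism of the fibre. -/
def jetFibreTo (γ : Arc Y) (hnm : n ≤ m) : γ.jetFibre n hnm ⟶ Over.mk (𝟙 (Spec (.of k))) :=
  pullback.snd _ _

lemma isPullback_jetFibre (γ : Arc Y) (hnm : n ≤ m) : IsPullback (jetFibreι γ hnm)
    (jetFibreTo γ hnm) ((jetTruncation k hnm).app Y) (γ.jet n) :=
  IsPullback.of_hasPullback ((jetTruncation k hnm).app Y) (γ.jet n)

/-- The family of discs corresponding to an `R`-point of the fibre. -/
def fibreDisc {ρ : k →+* R} {hnm : n ≤ m} {γ : Arc Y} (f : specOver ρ ⟶ γ.jetFibre n hnm) :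
    Spec (.of (TruncPoly m R)) ⟶ Y.left :=
  jetDiscOf (f ≫ jetFibreι γ hnm)

lemma fibreDisc_naturality {ρ : k →+* R} {ρ' : k →+* R'} {hnm : n ≤ m} {γ : Arc Y} (φ : R →+* R')
    (h : φ.comp ρ = ρ') (f : specOver ρ ⟶ γ.jetFibre n hnm) :
    fibreDisc (specOverMap φ h ≫ f) =
      Spec.map (CommRingCat.ofHom (TruncPoly.map m φ)) ≫ fibreDisc f := by
  rw [fibreDisc, Category.assoc, jetDiscOf_naturality]
  rfl

lemma fibreDisc_injective {ρ : k →+* R} {hnm : n ≤ m} {γ : Arc Y} :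
    Function.Injective (fibreDisc (ρ := ρ) (hnm := hnm) (γ := γ)) := by
  intro f g hfg
  refine (isPullback_jetFibre γ hnm).hom_ext (jetDiscOf_injective hfg) (Over.mkIdTerminal.hom_ext _ _)

lemma isDiscLift_fibreDisc {ρ : k →+* R} {hnm : n ≤ m} {γ : Arc Y}
    (f : specOver ρ ⟶ γ.jetFibre n hnm) : IsDiscLift γ hnm ρ (fibreDisc f) := by
  refine ⟨jetDiscOf_comp_hom _, ?_⟩
  rw [fibreDisc, ← jetDiscOf_truncation, Category.assoc, (isPullback_jetFibre γ hnm).w, ← jetDiscOf_jet,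
    ← Category.assoc]
  congr 2
  exact Over.mkIdTerminal.hom_ext _ _

/-- Together with `fibreDisc_injective` and `isDiscLift_fibreDisc` this identifies the R-points of
the fibre with the discs lifting the n-jet of γ. -/
lemma fibreDisc_surjective {ρ : k →+* R} {hnm : n ≤ m} {γ : Arc Y}
    {g : Spec (.of (TruncPoly m R)) ⟶ Y.left} (hg : IsDiscLift γ hnm ρ g) :
    ∃ f : specOver ρ ⟶ γ.jetFibre n hnm, fibreDisc f = g := by
  obtain ⟨a, rfl⟩ := jetDiscOf_surjective g hg.comp_hom
  refine ⟨(isPullback_jetFibre γ hnm).lift a (specOverHom ρ) ?_, ?_⟩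
  · apply jetDiscOf_injective
    rw [jetDiscOf_truncation, hg.reduce_comp, jetDiscOf_jet]
  · exact congrArg jetDiscOf ((isPullback_jetFibre γ hnm).lift_fst _ _ _)

end fibre

/-! ### Recognising affine schemes by their points; discs inside a chart. -/

section chart

variable {k : Type u} [CommRing k] {n m : ℕ} {R R' : Type u} [CommRing R] [CommRing R']

/-- A `k`-scheme whose `R`-points are `k`-algebra homomorphisms `P → R` is `Spec P`. -/
lemma isIso_of_existsUnique_specOverMap {X : Over (Spec (.of k))} {P : Type u} [CommRing P]
    {ρP : k →+* P} (a : specOver ρP ⟶ X)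
    (ha : ∀ {R : Type u} [CommRing R] (ρ : k →+* R) (f : specOver ρ ⟶ X),
      ∃! φ : P →+* R, ∃ h : φ.comp ρP = ρ, specOverMap φ h ≫ a = f) : IsIso a := by
  have key : IsIso (Scheme.zariskiTopology.yoneda.map a.left) := by
    refine isIso_of_bijective_affine _ fun R => ?_
    change Function.Bijective fun t : Spec R ⟶ Spec (.of P) => t ≫ a.left
    constructor
    · intro s t hst
      obtain ⟨φ, rfl⟩ := Spec.map_surjective s
      obtain ⟨ψ, rfl⟩ := Spec.map_surjective t
      dsimp only at hst
      -- Equal composites with `a` induce the same k-structure on R, so uniqueness can be applied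
      -- over a single ρ.
      have h : ψ.hom.comp ρP = φ.hom.comp ρP := by
        have := congrArg (· ≫ X.hom) hst
        simp only [Category.assoc] at this
        rw [Over.w a] at this
        change Spec.map φ ≫ Spec.map (CommRingCat.ofHom ρP) =
          Spec.map ψ ≫ Spec.map (CommRingCat.ofHom ρP) at this
        rw [← Spec.map_comp, ← Spec.map_comp] at this
        exact congrArg CommRingCat.Hom.hom (Spec.map_injective this).symm
      have := (ha (φ.hom.comp ρP) (specOverMap φ.hom rfl ≫ a)).unique ⟨rfl, rfl⟩
        (y₂ := ψ.hom) ⟨h, Over.OverMorphism.ext hst.symm⟩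
      exact congrArg Spec.map (CommRingCat.hom_ext this)
    · intro t
      obtain ⟨ρ, hρ⟩ := Spec.map_surjective (t ≫ X.hom)
      let f : specOver ρ.hom ⟶ X := Over.homMk t hρ.symm
      obtain ⟨φ, ⟨h, hφ⟩, -⟩ := ha ρ.hom f
      exact ⟨Spec.map (CommRingCat.ofHom φ), congrArg (fun z => z.left) hφ⟩
  have : IsIso a.left := isIso_of_reflects_iso a.left Scheme.zariskiTopology.yoneda
  have : IsIso ((Over.forget _).map a) := this
  exact isIso_of_reflects_iso a (Over.forget _)

variable {B : Type u} [CommRing B] {Y : Over (Spec (.of k))} {ι : Spec (.of B) ⟶ Y.left}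
  [IsOpenImmersion ι] {ρB : k →+* B} {γ : Arc Y} {g₀ : B →+* PowerSeries k}

/-- The kernel is generated by a positive power of the class of X, which is nilpotent and so lies in
every prime. -/
lemma TruncPoly.ker_reduce_le (h : n ≤ m) (x : PrimeSpectrum (TruncPoly m R)) :
    RingHom.ker (TruncPoly.reduce R h) ≤ x.asIdeal := by
  intro y hy
  obtain ⟨q, rfl⟩ := Ideal.Quotient.mk_surjective y
  have hy' : (Ideal.Quotient.mk (Ideal.span {(X : R[X]) ^ (n + 1)})) q = 0 := hy
  rw [Ideal.Quotient.eq_zero_iff_mem, Ideal.mem_span_singleton] at hy'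
  obtain ⟨r, rfl⟩ := hy'
  rw [map_mul, map_pow]
  refine Ideal.mul_mem_right _ _ (Ideal.pow_mem_of_mem _ (x.2.mem_of_pow_mem (m + 1) ?_) _
    (Nat.succ_pos n))
  rw [← map_pow, Ideal.Quotient.eq_zero_iff_mem.2 (Ideal.mem_span_singleton_self _)]
  exact zero_mem _

lemma surjective_specMap_reduce (R : Type u) [CommRing R] (h : n ≤ m) :
    Surjective (Spec.map (CommRingCat.ofHom (TruncPoly.reduce R h))) := by
  refine ⟨fun x => ?_⟩
  have hf : Function.Surjective (TruncPoly.reduce R h) := Ideal.Quotient.factor_surjective _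
  have hx : x ∈ Set.range (PrimeSpectrum.comap (TruncPoly.reduce R h)) := by
    rw [range_comap_of_surjective _ _ hf]
    exact TruncPoly.ker_reduce_le h x
  exact hx

/-- The m-disc has the same points as the n-disc, which is mapped into the chart through γ. So every
lift stays in the open chart, and the fibre can be computed there. -/
lemma IsDiscLift.exists_eq (hg₀ : Spec.map (CommRingCat.ofHom g₀) ≫ ι = γ.left) {hnm : n ≤ m}
    {ρ : k →+* R} {g : Spec (.of (TruncPoly m R)) ⟶ Y.left} (hg : IsDiscLift γ hnm ρ g) :
    ∃ ψ : B →+* TruncPoly m R, Spec.map (CommRingCat.ofHom ψ) ≫ ι = g := by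
  have hr : Set.range g ⊆ Set.range ι := by
    rintro _ ⟨x, rfl⟩
    obtain ⟨x, rfl⟩ := (surjective_specMap_reduce R hnm).surj x
    rw [← Scheme.Hom.comp_apply, hg.reduce_comp, ← hg₀]
    exact ⟨_, rfl⟩
  obtain ⟨ψ, hψ⟩ := Spec.map_surjective (IsOpenImmersion.lift ι g hr)
  exact ⟨ψ.hom, by rw [CommRingCat.ofHom_hom, hψ, IsOpenImmersion.lift_fac]⟩

lemma specMap_comp_injective {T : Type u} [CommRing T] {ψ ψ' : B →+* T}
    (h : Spec.map (CommRingCat.ofHom ψ) ≫ ι = Spec.map (CommRingCat.ofHom ψ') ≫ ι) : ψ = ψ' :=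
  congrArg CommRingCat.Hom.hom (Spec.map_injective ((cancel_mono ι).1 h))

lemma isDiscLift_specMap_comp_iff (hι : ι ≫ Y.hom = Spec.map (CommRingCat.ofHom ρB))
    (hg₀ : Spec.map (CommRingCat.ofHom g₀) ≫ ι = γ.left) {hnm : n ≤ m}
    {ρ : k →+* R} (ψ : B →+* TruncPoly m R) :
    IsDiscLift γ hnm ρ (Spec.map (CommRingCat.ofHom ψ) ≫ ι) ↔
      ψ.comp ρB = (algebraMap R (TruncPoly m R)).comp ρ ∧
      (TruncPoly.reduce R hnm).comp ψ = (TruncPoly.map n ρ).comp ((truncHom n k).comp g₀) := by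
  have h1 : (Spec.map (CommRingCat.ofHom ψ) ≫ ι) ≫ Y.hom =
      Spec.map (CommRingCat.ofHom (ψ.comp ρB)) := by
    rw [Category.assoc, hι, ← Spec.map_comp]
    rfl
  have h2 : Spec.map (CommRingCat.ofHom (TruncPoly.reduce R hnm)) ≫
      Spec.map (CommRingCat.ofHom ψ) ≫ ι =
        Spec.map (CommRingCat.ofHom ((TruncPoly.reduce R hnm).comp ψ)) ≫ ι := by
    rw [← Category.assoc, ← Spec.map_comp]
    rfl
  have h3 : (Spec.map (CommRingCat.ofHom (TruncPoly.map n ρ)) ≫ discToFormalDisc n k) ≫ γ.left =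
      Spec.map (CommRingCat.ofHom ((TruncPoly.map n ρ).comp ((truncHom n k).comp g₀))) ≫ ι := by
    rw [← hg₀]
    refine (Category.assoc _ _ _).symm.trans (congrArg (· ≫ ι) ?_)
    rw [discToFormalDisc, ← Spec.map_comp]
    exact (Spec.map_comp _ _).symm
  constructor
  · rintro ⟨h4, h5⟩
    rw [h1] at h4
    rw [h2, h3] at h5
    exact ⟨congrArg CommRingCat.Hom.hom (Spec.map_injective h4), specMap_comp_injective h5⟩
  · rintro ⟨h4, h5⟩
    refine ⟨?_, ?_⟩
    · rw [h1, h4]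
    · rw [h2, h3, h5]

end chart

/-! ### Homomorphisms out of the coordinate ring as tuples of coordinates. -/

section lift

variable {k : Type u} [CommRing k] {n m : ℕ} {R : Type u} [CommRing R] {σ : Type*}
  {B : Type u} [CommRing B] {c : ℕ} {h : Fin c → MvPolynomial σ k}

lemma isJetLift_of_ringHom (π : MvPolynomial σ k →+* B) (hπ : ∀ l, π (h l) = 0)
    (g₀ : B →+* PowerSeries k) (hnm : n ≤ m) {ρ : k →+* R} {ψ : B →+* TruncPoly m R}
    (h1 : ψ.comp (π.comp MvPolynomial.C) = (algebraMap R (TruncPoly m R)).comp ρ)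
    (h2 : (TruncPoly.reduce R hnm).comp ψ = (TruncPoly.map n ρ).comp ((truncHom n k).comp g₀)) :
    IsJetLift h (fun i => g₀ (π (.X i))) hnm ρ fun i => ψ (π (.X i)) := by
  refine ⟨fun i => ?_, fun l => ?_⟩
  · rw [← map_truncHom]
    exact congr($h2 (π (.X i)))
  · rw [← h1]
    have : (MvPolynomial.eval₂Hom (ψ.comp (π.comp MvPolynomial.C)) fun i => ψ (π (.X i))) =
        ψ.comp π := by
      apply MvPolynomial.ringHom_ext
      · intro r; simp
      · intro i; simp
    refine (congr($this (h l))).trans ?_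
    rw [RingHom.comp_apply, hπ, map_zero]

/-- Evaluation at `y` kills the generators h of the kernel of π and so descends to B. The reduction
condition needs checking only on constants and variables. -/
lemma IsJetLift.exists_ringHom {π : MvPolynomial σ k →+* B} (hπ : Function.Surjective π)
    (hker : RingHom.ker π = Ideal.span (Set.range h))
    {g₀ : B →+* PowerSeries k} (hg₀ : g₀.comp (π.comp MvPolynomial.C) = PowerSeries.C)
    {hnm : n ≤ m} {ρ : k →+* R}
    {y : σ → TruncPoly m R} (hy : IsJetLift h (fun i => g₀ (π (.X i))) hnm ρ y) :
    ∃ ψ : B →+* TruncPoly m R, (∀ i, ψ (π (.X i)) = y i) ∧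
      ψ.comp (π.comp MvPolynomial.C) = (algebraMap R (TruncPoly m R)).comp ρ ∧
      (TruncPoly.reduce R hnm).comp ψ = (TruncPoly.map n ρ).comp ((truncHom n k).comp g₀) := by
  let ev := MvPolynomial.eval₂Hom ((algebraMap R (TruncPoly m R)).comp ρ) y
  have hev : RingHom.ker π ≤ RingHom.ker ev := by
    rw [hker, Ideal.span_le]
    rintro _ ⟨l, rfl⟩
    exact hy.2 l
  let ψ : B →+* TruncPoly m R := RingHom.liftOfSurjective π hπ ⟨ev, hev⟩
  have hψ (p) : ψ (π p) = ev p :=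
    RingHom.liftOfRightInverse_comp_apply π _ (Function.rightInverse_surjInv hπ) ⟨ev, hev⟩ p
  have h1 : ψ.comp (π.comp MvPolynomial.C) = (algebraMap R (TruncPoly m R)).comp ρ := by
    ext r
    simp only [RingHom.comp_apply, hψ]
    exact MvPolynomial.eval₂_C _ _ _
  have h0 (i) : ψ (π (.X i)) = y i := (hψ _).trans (MvPolynomial.eval₂_X _ _ _)
  refine ⟨ψ, h0, h1, ?_⟩
  rw [← RingHom.cancel_right hπ]
  apply MvPolynomial.ringHom_ext
  · intro r
    have e1 : ψ (π (.C r)) = algebraMap R _ (ρ r) := congr($h1 r)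
    have e2 : g₀ (π (.C r)) = PowerSeries.C r := congr($hg₀ r)
    simp only [RingHom.comp_apply, e1, e2]
    rw [← truncHom_C, reduce_truncHom, map_truncHom, PowerSeries.map_C]
  · intro i
    simp only [RingHom.comp_apply, h0, map_truncHom]
    exact hy.1 i

end lift

/-! ### The fibre in a chart. -/

/-- The fibre over the jet of an arc in a chart `V(h) ⊆ 𝔸^σ` is an affine space. -/
lemma nonempty_jetFibre_iso {k : Type u} [Field k] {n m d e c : ℕ} {σ : Type*} [Fintype σ]
    [DecidableEq σ] {B : Type u} [CommRing B] {h : Fin c → MvPolynomial σ k}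
    {Y : Over (Spec (.of k))} {ι : Spec (.of B) ⟶ Y.left} [IsOpenImmersion ι]
    {γ : Arc Y} {g₀ : B →+* PowerSeries k} {π : MvPolynomial σ k →+* B}
    (hι : ι ≫ Y.hom = Spec.map (CommRingCat.ofHom (π.comp MvPolynomial.C)))
    (hg₀ : Spec.map (CommRingCat.ofHom g₀) ≫ ι = γ.left)
    (hg₁ : g₀.comp (π.comp MvPolynomial.C) = PowerSeries.C)
    (hπ : Function.Surjective π) (hker : RingHom.ker π = Ideal.span (Set.range h))
    (hσ : Fintype.card σ = c + d)
    (s : Fin c → σ)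
    (hs : (Matrix.of fun l j => g₀ (π (MvPolynomial.pderiv (s j) (h l)))).det.order = e)
    (hs' : ∀ s : Fin c → σ, (e : ℕ∞) ≤ (Matrix.of fun l j => g₀ (π
      (MvPolynomial.pderiv (s j) (h l)))).det.order)
    (hm : n + e ≤ m) (hn : e ≤ n) :
    Nonempty (γ.jetFibre n (Nat.le_of_add_right_le hm) ≅
      specOver (MvPolynomial.C : k →+* MvPolynomial (Fin ((m - n) * d + e)) k)) := by
  have hev (p) : MvPolynomial.eval₂ PowerSeries.C (fun i => g₀ (π (.X i))) p = g₀ (π p) := by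
    have : MvPolynomial.eval₂Hom PowerSeries.C (fun i => g₀ (π (.X i))) = g₀.comp π := by
      apply MvPolynomial.ringHom_ext
      · intro r
        rw [MvPolynomial.eval₂Hom_C, ← hg₁]
        rfl
      · intro i; simp
    exact congr($this p)
  have hz (l) : π (h l) = 0 := by
    rw [← RingHom.mem_ker, hker]
    exact Ideal.subset_span ⟨l, rfl⟩
  obtain ⟨x, hx, hx'⟩ := exists_universal_isJetLift (n := n) hσ h (fun i => g₀ (π (.X i)))
    (fun l => by rw [hev, hz, map_zero]) s (by simpa only [hev] using hs)
    (by simpa only [hev] using hs') hm hn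
  obtain ⟨ψx, hψx, hψ1, hψ2⟩ := hx.exists_ringHom hπ hker hg₁
  -- The universal tuple, read as a point of the fibre over the polynomial ring, is the candidate
  -- isomorphism.
  obtain ⟨a, ha⟩ := fibreDisc_surjective ((isDiscLift_specMap_comp_iff hι hg₀ ψx).2 ⟨hψ1, hψ2⟩)
  have : IsIso a := by
    refine isIso_of_existsUnique_specOverMap a fun {R} _ ρ f => ?_
    obtain ⟨ψ, hψ⟩ := (isDiscLift_fibreDisc f).exists_eq hg₀
    have hψd := isDiscLift_fibreDisc f
    rw [← hψ, isDiscLift_specMap_comp_iff hι hg₀] at hψd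
    have hy := isJetLift_of_ringHom (h := h) π hz g₀ _ hψd.1 hψd.2
    have key (φ : MvPolynomial (Fin ((m - n) * d + e)) k →+* R) :
        (φ.comp MvPolynomial.C = ρ ∧ ∀ i, TruncPoly.map m φ (x i) = ψ (π (.X i))) ↔
          ∃ hφ : φ.comp MvPolynomial.C = ρ, specOverMap φ hφ ≫ a = f := by
      rw [← exists_prop]
      refine exists_congr fun hφ => ?_
      rw [← fibreDisc_injective.eq_iff, fibreDisc_naturality, ha, ← hψ, ← Category.assoc,
        ← Spec.map_comp]
      constructor
      · intro hi
        refine congrArg (fun z => Spec.map (CommRingCat.ofHom z) ≫ ι) (?_ :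
          (TruncPoly.map m φ).comp ψx = ψ)
        rw [← RingHom.cancel_right hπ]
        apply MvPolynomial.ringHom_ext
        · intro r
          have e1 : ψx (π (.C r)) = algebraMap (MvPolynomial (Fin ((m - n) * d + e)) k) _ (.C r) := congr($hψ1 r)
          have e2 : ψ (π (.C r)) = algebraMap _ _ (ρ r) := congr($(hψd.1) r)
          simp only [RingHom.comp_apply, e1, e2, ← truncHom_C, map_truncHom, PowerSeries.map_C]
          rw [← hφ]
          rfl
        · intro i
          simp only [RingHom.comp_apply, hψx, hi]
      · intro hi i
        have := specMap_comp_injective (ψ := (TruncPoly.map m φ).comp ψx) hi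
        rw [← this, ← hψx]
        rfl
    simpa only [key] using hx' ρ _ hy
  exact ⟨(asIso a).symm⟩

lemma fittingIdeal_kaehlerDifferential_away {k A A' : Type u} [CommRing k] [CommRing A]
    [CommRing A'] [Algebra k A] [Algebra k A'] [Algebra A A'] [IsScalarTower k A A']
    [Algebra.FiniteType k A] (d : ℕ) (f : A) [IsLocalization.Away f A'] :
    (fittingIdeal d A (Ω[A⁄k])).map (algebraMap A A') = fittingIdeal d A' (Ω[A'⁄k]) :=
  fittingIdeal_map_of_isLocalizedModule (Submonoid.powers f) (KaehlerDifferential.map k k A A') d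

/-! ### The Jacobian ideal sheaf on charts and its pullback to an arc. -/

section jacobian

variable {k : Type u} [CommRing k] {Y : Over (Spec (.of k))}

lemma sectionsHom_restrict {U V : Y.left.Opens} (i : V ⟶ U) :
    (Y.left.presheaf.map i.op).hom.comp (sectionsHom Y U) = sectionsHom Y V := by
  refine congrArg CommRingCat.Hom.hom (?_ :
    ((Scheme.ΓSpecIso (.of k)).inv ≫ Y.hom.appLE ⊤ U le_top) ≫ Y.left.presheaf.map i.op =
      (Scheme.ΓSpecIso (.of k)).inv ≫ Y.hom.appLE ⊤ V le_top)
  exact (Category.assoc _ _ _).trans (congrArg (_ ≫ ·) (Scheme.Hom.appLE_map _ _ _))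

lemma finiteType_sectionsHom [LocallyOfFiniteType Y.hom] {U : Y.left.Opens}
    (hU : IsAffineOpen U) : (sectionsHom Y U).FiniteType := by
  refine RingHom.FiniteType.comp (Y.hom.finiteType_appLE (isAffineOpen_top _) hU le_top)
    (RingHom.FiniteType.of_surjective _ ?_)
  exact (ConcreteCategory.bijective_of_isIso (Scheme.ΓSpecIso (.of k)).inv).2

/-- The Jacobian ideal on an affine open subset is a Fitting ideal. -/
lemma jacobianIdeal_ideal [LocallyOfFiniteType Y.hom] (d : ℕ) (U : Y.left.affineOpens) :
    letI := (sectionsHom Y U.1).toAlgebra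
    (jacobianIdeal d Y).ideal U = fittingIdeal d Γ(Y.left, U.1) (Ω[Γ(Y.left, U.1)⁄k]) := by
  -- Compatibility with basic opens makes the Fitting ideals an ideal sheaf, so passing to the
  -- largest ideal sheaf contained in them changes nothing.
  let J : Y.left.IdealSheafData :=
    { ideal := fun U =>
        letI := (sectionsHom Y U.1).toAlgebra
        fittingIdeal d Γ(Y.left, U.1) (Ω[Γ(Y.left, U.1)⁄k])
      map_ideal_basicOpen := fun U f => by
        let := (sectionsHom Y U.1).toAlgebra
        let := (sectionsHom Y (Y.left.affineBasicOpen f).1).toAlgebra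
        let : Algebra Γ(Y.left, U.1) Γ(Y.left, (Y.left.affineBasicOpen f).1) :=
          (Y.left.presheaf.map (homOfLE <| Y.left.basicOpen_le f).op).hom.toAlgebra
        have : IsScalarTower k Γ(Y.left, U.1) Γ(Y.left, (Y.left.affineBasicOpen f).1) :=
          .of_algebraMap_eq' (sectionsHom_restrict _).symm
        have : Algebra.FiniteType k Γ(Y.left, U.1) := finiteType_sectionsHom U.2
        have : IsLocalization.Away f Γ(Y.left, (Y.left.affineBasicOpen f).1) :=
          U.2.isLocalization_basicOpen f
        exact fittingIdeal_kaehlerDifferential_away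
          (A' := Γ(Y.left, (Y.left.affineBasicOpen f).1)) d f }
  exact congr($(Scheme.IdealSheafData.ofIdeals_ideal J).ideal U)

/-- Pullback of ideal sheaves is left adjoint to pushforward, and on affine schemes the pushforward
is the preimage of ideals, whose left adjoint is extension. -/
lemma ideal_comap_of_isAffine {X Z : Scheme.{u}} [IsAffine X] [IsAffine Z] (f : X ⟶ Z)
    (J : Z.IdealSheafData) :
    (J.comap f).ideal ⟨⊤, isAffineOpen_top _⟩ =
      (J.ideal ⟨⊤, isAffineOpen_top _⟩).map f.appTop.hom := by
  apply le_antisymm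
  · let K : X.IdealSheafData := Scheme.IdealSheafData.equivOfIsAffine.symm
      ((J.ideal ⟨⊤, isAffineOpen_top _⟩).map f.appTop.hom)
    have hK : K.ideal ⟨⊤, isAffineOpen_top _⟩ =
        (J.ideal ⟨⊤, isAffineOpen_top _⟩).map f.appTop.hom :=
      Scheme.IdealSheafData.equivOfIsAffine.apply_symm_apply _
    have h : J ≤ K.map f := by
      rw [← map_le_map_iff Scheme.IdealSheafData.equivOfIsAffine]
      simp only [Scheme.IdealSheafData.equivOfIsAffine_apply]
      rw [Scheme.IdealSheafData.ideal_map_of_isAffineHom, ← Ideal.map_le_iff_le_comap]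
      exact hK.ge
    exact ((Scheme.IdealSheafData.le_map_iff_comap_le.1 h) _).trans hK.le
  · have := Scheme.IdealSheafData.le_map_comap J f ⟨⊤, isAffineOpen_top _⟩
    rw [Scheme.IdealSheafData.ideal_map_of_isAffineHom] at this
    exact Ideal.map_le_iff_le_comap.2 this

variable {B : Type u} [CommRing B] {ι : Spec (.of B) ⟶ Y.left} [IsOpenImmersion ι]

/-- The image of an affine chart. -/
def chartOpen (ι : Spec (.of B) ⟶ Y.left) [IsOpenImmersion ι] : Y.left.affineOpens :=
  ⟨ι ''ᵁ ⊤, (isAffineOpen_top _).image_of_isOpenImmersion ι⟩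

/-- The sections on an affine chart. -/
def chartEquiv (ι : Spec (.of B) ⟶ Y.left) [IsOpenImmersion ι] :
    Γ(Y.left, (chartOpen ι).1) ≃+* B :=
  (ι.appIso ⊤ ≪≫ Scheme.ΓSpecIso (.of B)).commRingCatIsoToRingEquiv

lemma chartEquiv_sectionsHom {ρB : k →+* B} (hι : ι ≫ Y.hom = Spec.map (CommRingCat.ofHom ρB)) :
    (chartEquiv ι : _ →+* B).comp (sectionsHom Y (chartOpen ι).1) = ρB := by
  have h1 : Y.hom.appLE ⊤ (ι ''ᵁ ⊤) le_top ≫ (ι.appIso ⊤).hom =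
      (Spec.map (CommRingCat.ofHom ρB)).appTop := by
    rw [Scheme.Hom.appIso_hom']
    refine (Scheme.Hom.appLE_comp_appLE _ _ _ _ _ _ _).trans ?_
    simp only [hι]
    exact (Scheme.Hom.app_eq_appLE _).symm
  have h2 : ((Scheme.ΓSpecIso (.of k)).inv ≫ Y.hom.appLE ⊤ (ι ''ᵁ ⊤) le_top) ≫
      (ι.appIso ⊤).hom ≫ (Scheme.ΓSpecIso (.of B)).hom = CommRingCat.ofHom ρB := by
    have h3 {P Q R S T : CommRingCat.{u}} (a : P ⟶ Q) (b : Q ⟶ R) (c : R ⟶ S) (e : S ⟶ T) :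
        (a ≫ b) ≫ c ≫ e = a ≫ (b ≫ c) ≫ e := by
      simp only [Category.assoc]
    refine (h3 _ _ _ _).trans ?_
    rw [h1, Scheme.ΓSpecIso_naturality, Iso.inv_hom_id_assoc]
  exact congrArg CommRingCat.Hom.hom h2

lemma map_jacobianIdeal_chartEquiv [LocallyOfFiniteType Y.hom] [Algebra k B] (d : ℕ)
    (hι : ι ≫ Y.hom = Spec.map (CommRingCat.ofHom (algebraMap k B))) :
    ((jacobianIdeal d Y).ideal (chartOpen ι)).map (chartEquiv ι : _ →+* B) =
      fittingIdeal d B (Ω[B⁄k]) := by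
  let := (sectionsHom Y (chartOpen ι).1).toAlgebra
  have : Algebra.FiniteType k Γ(Y.left, (chartOpen ι).1) := finiteType_sectionsHom (chartOpen ι).2
  rw [jacobianIdeal_ideal]
  exact fittingIdeal_map_ringEquiv (AlgEquiv.ofRingEquiv (f := chartEquiv ι)
    fun r => congr($(chartEquiv_sectionsHom hι) r)) d

/-- This reduces orders along γ to generators of the ideal on a single chart. -/
lemma Arc.ideal_eq_map {γ : Arc Y} {g₀ : B →+* PowerSeries k}
    (hg₀ : Spec.map (CommRingCat.ofHom g₀) ≫ ι = γ.left) (I : Y.left.IdealSheafData) :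
    γ.ideal I = ((I.ideal (chartOpen ι)).map (chartEquiv ι : _ →+* B)).map g₀ := by
  let f : Spec (.of (PowerSeries k)) ⟶ Y.left := γ.left
  change ((I.comap f).ideal ⟨⊤, isAffineOpen_top _⟩).map
    (Scheme.ΓSpecIso (.of (PowerSeries k))).hom.hom = _
  rw [show f = Spec.map (CommRingCat.ofHom g₀) ≫ ι from hg₀.symm,
    Scheme.IdealSheafData.comap_comp, ideal_comap_of_isAffine, Ideal.map_map,
    Scheme.IdealSheafData.ideal_comap_of_isOpenImmersion]
  have h1 : (I.ideal (chartOpen ι)).comap (ι.appIso ⊤).inv.hom =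
      (I.ideal (chartOpen ι)).map (ι.appIso ⊤).hom.hom :=
    (Ideal.map_comap_of_equiv (ι.appIso ⊤).commRingCatIsoToRingEquiv).symm
  have h2 := Scheme.ΓSpecIso_naturality (CommRingCat.ofHom g₀)
  refine (congrArg _ h1).trans ?_
  refine (Ideal.map_map _ _).trans (Eq.trans (congrArg (Ideal.map · _) ?_)
    (Ideal.map_map _ _).symm)
  have h3 : (ι.appIso ⊤).hom ≫ (Spec.map (CommRingCat.ofHom g₀)).appTop ≫
      (Scheme.ΓSpecIso (.of (PowerSeries k))).hom =
    ((ι.appIso ⊤).hom ≫ (Scheme.ΓSpecIso (.of B)).hom) ≫ CommRingCat.ofHom g₀ := by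
    rw [h2, Category.assoc]
  exact congrArg CommRingCat.Hom.hom h3

end jacobian

/-! ### Orders of ideals, the chart through an arc, and the conclusion. -/

lemma X_pow_dvd_iff_le_order {k : Type*} [CommRing k] {f : PowerSeries k} {e : ℕ} :
    PowerSeries.X ^ e ∣ f ↔ (e : ℕ∞) ≤ f.order := by
  rw [PowerSeries.X_pow_dvd_iff]
  exact ⟨PowerSeries.nat_le_order f e, fun h i hi =>
    PowerSeries.coeff_of_lt_order i ((Nat.cast_lt.2 hi).trans_le h)⟩

/-- If no generator had order e, all would be divisible by X^{e+1}, and so would the whole ideal. -/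
lemma exists_order_eq_of_iInf_span {k α : Type*} [CommRing k] (v : α → PowerSeries k) (e : ℕ)
    (he : ⨅ f ∈ Ideal.span (Set.range v), PowerSeries.order f = e) :
    (∀ a, (e : ℕ∞) ≤ (v a).order) ∧ ∃ a, (v a).order = e := by
  have h1 (a) : (e : ℕ∞) ≤ (v a).order := by
    rw [← he]
    exact biInf_le _ (Ideal.subset_span ⟨a, rfl⟩)
  refine ⟨h1, ?_⟩
  by_contra! h2
  have h3 : Ideal.span (Set.range v) ≤ Ideal.span {PowerSeries.X ^ (e + 1)} := by
    rw [Ideal.span_le]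
    rintro _ ⟨a, rfl⟩
    rw [SetLike.mem_coe, Ideal.mem_span_singleton, X_pow_dvd_iff_le_order]
    push_cast
    exact Order.add_one_le_of_lt (lt_of_le_of_ne (h1 a) (h2 a).symm)
  have h4 : ((e + 1 : ℕ) : ℕ∞) ≤ ⨅ f ∈ Ideal.span (Set.range v), PowerSeries.order f := by
    refine le_iInf₂ fun f hf => ?_
    rw [← X_pow_dvd_iff_le_order]
    exact Ideal.mem_span_singleton.1 (h3 hf)
  rw [he, Nat.cast_le] at h4
  omega

lemma ringKrullDim_of_isPureDim {d : ℕ} {Y : Scheme.{u}} (hd : IsPureDim d Y) {B : CommRingCat.{u}}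
    [Nontrivial B] (ι : Spec B ⟶ Y) [IsOpenImmersion ι] : ringKrullDim B = d := by
  have hne : (ι.opensRange : Set Y).Nonempty := ⟨_, (Classical.arbitrary (PrimeSpectrum B)), rfl⟩
  rw [← hd ι.opensRange hne, ← PrimeSpectrum.topologicalKrullDim_eq_ringKrullDim]
  exact IsHomeomorph.topologicalKrullDim_eq _
    (ι.isOpenEmbedding.isEmbedding.toHomeomorph.isHomeomorph)

/-- Every point of Spec k⟦X⟧ specializes to the closed point, so an open set containing the image of
the closed point contains the whole image. -/
lemma Arc.exists_chart {k : Type u} [Field k] {Y : Over (Spec (.of k))} (γ : Arc Y) {B : Type u}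
    [CommRing B] (ι : Spec (.of B) ⟶ Y.left) [IsOpenImmersion ι]
    (h : γ.left (IsLocalRing.closedPoint (PowerSeries k)) ∈ Set.range ι) :
    ∃ g₀ : B →+* PowerSeries k, Spec.map (CommRingCat.ofHom g₀) ≫ ι = γ.left := by
  let f : Spec (.of (PowerSeries k)) ⟶ Y.left := γ.left
  have hr : Set.range f ⊆ Set.range ι := by
    rintro _ ⟨x, rfl⟩
    exact ((IsLocalRing.specializes_closedPoint (R := PowerSeries k) x).map
      f.continuous).mem_open ι.isOpenEmbedding.isOpen_range h
  obtain ⟨g, hg⟩ := Spec.map_surjective (IsOpenImmersion.lift ι f hr)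
  exact ⟨g.hom, by rw [CommRingCat.ofHom_hom, hg]; exact IsOpenImmersion.lift_fac _ _ _⟩

/-- Affine space as the spectrum of a polynomial ring. -/
def specOverMvPolynomialIso (k : Type u) [CommRing k] (M : ℕ) :
    specOver (MvPolynomial.C : k →+* MvPolynomial (Fin M) k) ≅
      Over.mk (𝔸(ULift.{u} (Fin M); Spec (.of k)) ↘ Spec (.of k)) :=
  Over.isoMk (Scheme.Spec.mapIso
      (MvPolynomial.renameEquiv k Equiv.ulift.{u}).toRingEquiv.toCommRingCatIso.op ≪≫
    (AffineSpace.SpecIso (ULift.{u} (Fin M)) (.of k)).symm) (by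
      refine (Category.assoc _ _ _).trans ?_
      refine (congrArg (_ ≫ ·) (AffineSpace.SpecIso_inv_over _)).trans ?_
      refine (Spec.map_comp _ _).symm.trans (congrArg Spec.map ?_)
      exact CommRingCat.hom_ext (RingHom.ext fun r => MvPolynomial.rename_C Equiv.ulift r))

end JetScheme

end

theorem proposition4p4 {k : Type u} [Field k] [IsAlgClosed k] (d : ℕ) (Y : Over (Spec (.of k)))
    [LocallyOfFiniteType Y.hom] [QuasiCompact Y.hom] (hY : JetScheme.IsLCI Y)
    (hd : JetScheme.IsPureDim d Y.left) (γ : JetScheme.Arc Y) (e m n : ℕ)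
    (he : γ.order (JetScheme.jacobianIdeal d Y) = e)
    (hm : n + e ≤ m) (hn : 2 * e ≤ n + e) :
    Nonempty (γ.jetFibre n (Nat.le_of_add_right_le hm) ≅
      Over.mk (𝔸(ULift.{u} (Fin ((m - n) * d + e)); Spec (.of k)) ↘ Spec (.of k))) := by
  obtain ⟨N, h, ι, hreg, _, hy, hι⟩ := hY (γ.left (IsLocalRing.closedPoint (PowerSeries k)))
  let π : MvPolynomial (Fin N) k →+* MvPolynomial (Fin N) k ⧸ Ideal.ofList h :=
    Ideal.Quotient.mk _
  have hπ : Function.Surjective π := Ideal.Quotient.mk_surjective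
  have hofList : Ideal.ofList h = Ideal.span (Set.range h.get) := by
    rw [Ideal.ofList, Set.range_list_get]
  have hker : RingHom.ker π = Ideal.span (Set.range h.get) := by
    rw [← hofList]
    exact Ideal.mk_ker
  obtain ⟨g₀, hg₀⟩ := γ.exists_chart ι hy
  -- The chart is non-empty because its coordinate ring maps to k⟦X⟧; purity of dimension then
  -- applies to it.
  have : Nontrivial (CommRingCat.of (MvPolynomial (Fin N) k ⧸ Ideal.ofList h)) :=
    g₀.domain_nontrivial
  -- The number of equations is the codimension N - d, so the d-th Fitting ideal consists of maximal
  -- minors.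
  have hN : Fintype.card (Fin N) = h.length + d := by
    have := JetScheme.ringKrullDim_quotient_ofList h hreg
    rw [JetScheme.ringKrullDim_of_isPureDim (B := .of (MvPolynomial (Fin N) k ⧸ Ideal.ofList h))
      hd ι] at this
    rw [Fintype.card_fin, add_comm]
    exact_mod_cast this.symm
  have hg₁ : g₀.comp (π.comp MvPolynomial.C) = PowerSeries.C := by
    have h1 : (Spec.map (CommRingCat.ofHom g₀) ≫ ι) ≫ Y.hom = (JetScheme.formalDisc k).hom :=
      (congrArg (· ≫ Y.hom) hg₀).trans (Over.w γ)
    have h2 := (Spec.map_comp _ _).trans ((congrArg (_ ≫ ·) hι).symm.trans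
      ((Category.assoc _ _ _).symm.trans h1))
    exact congrArg CommRingCat.Hom.hom (Spec.map_injective h2)
  have hideal := JetScheme.Arc.ideal_eq_map hg₀ (JetScheme.jacobianIdeal d Y)
  rw [JetScheme.map_jacobianIdeal_chartEquiv d hι,
    JetScheme.fittingIdeal_quotient hπ h.get hker hN, Ideal.map_span, ← Set.range_comp] at hideal
  rw [JetScheme.Arc.order, hideal] at he
  -- All maximal minors of the Jacobian matrix have order at least e along γ, and the columns s give
  -- one of order exactly e.
  obtain ⟨h1, s, h2⟩ := JetScheme.exists_order_eq_of_iInf_span _ e he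
  have hdet (s : Fin h.length → Fin N) : g₀ (Matrix.det (Matrix.of fun i j =>
      π (MvPolynomial.pderiv (s j) (h.get i)))) =
      (Matrix.of fun i j => g₀ (π (MvPolynomial.pderiv (s j) (h.get i)))).det :=
    g₀.map_det _
  obtain ⟨E⟩ := JetScheme.nonempty_jetFibre_iso (n := n) hι hg₀ hg₁ hπ hker hN s
    ((congrArg _ (hdet s)).symm.trans h2) (fun s => (h1 s).trans_eq (congrArg _ (hdet s))) hm
    (by omega)
  exact ⟨E ≪≫ JetScheme.specOverMvPolynomialIso k _⟩
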